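/- Let $q\in L_1[0,1]$ be complex-valued (continued with period $1$), with Fourier coefficients $q_n=\int_0^1 q(x)e^{-2\pi i n x}\,dx$ satisfying $q_n=0$ for all integers $n\le 0$ (that is, $q\in L_1^+[0,1]$). For $t\in\mathbb{C}$ let $L_t(q)$ be the operator generated in $L_2[0,1]$ by $-y''+qy$ and the boundary conditions $y(1)=e^{it}y(0)$, $y'(1)=e^{it}y'(0)$. For $n\in\mathbb{Z}$ and $t\in\mathbb{C}\setminus\pi\mathbb{Z}$ there is exactly one eigenfunction $\Psi_{n,t}$ of $L_t(q)$ for the eigenvalue $(2\pi n+t)^2$ with $\int_0^1\Psi_{n,t}(x)e^{-i(2\pi n+t)x}\,dx=1$; it is continued to $\mathbb{R}$ by $\Psi_{n,t}(x+1)=e^{it}\Psi_{n,t}(x)$. For $n\ge 1$, $t=0$ and for $n\ge 0$, $t=\pi$ put $$\Psi_{n,t}(x)=e^{i(2\pi n+t)x}+\sum_{p\ge 1}c_{p,n}(t)e^{i(2\pi(n+p)+t)x},$$ $$c_{p,n}(t)=\frac{-1}{2\pi p(2\pi(2n+p)+2t)}\Bigl(q_p+\sum_{k=1}^{p-1}\sum_{n_1,\dots,n_k}\frac{q_{n_1}\cdots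 q_{n_k}\,q_{p-n(k)}}{\prod_{s=1}^{k}\bigl[(2\pi(2n+p-n(s))+2t)\cdot 2\pi(n(s)-p)\bigr]}\Bigr),$$ where $n(s)=n_1+\dots+n_s$ and the inner sum is over all positive integers $n_1,\dots,n_k$ with $p-n(k)\ge 1$; here $\sum_p|c_{p,n}(t)|<\infty$. For $n\ge1$ put $$s_n=q_n+\sum_{k=1}^{n-1}\sum_{n_1,\dots,n_k}\frac{q_{n_1}\cdots q_{n_k}\,q_{n-n(k)}}{\prod_{s=1}^{k}\bigl[2\pi n(s)\cdot 2\pi(n-n(s))\bigr]},$$ the inner sum being over all positive integers $n_1,\dots,n_k$ with $n-n(k)\ge 1$. Then $$\lim_{t\to 0}8n\pi t\,\Psi_{-n,-t}(x)=s_{2n}\Psi_{n,0}(x)\quad\text{for all } n\ge 1,$$ $$\lim_{t\to \pi}4(2n+1)(t-\pi)\pi\,\Psi_{-n,-t}(x)=s_{2n+1}\Psi_{n,\pi}(x)\quad\text{for all } n\ge 0,$$ where $t$ tends to $0$ (respectively $\pi$) through complex values different from the limit, and the convergence is locally uniform in $x\in\mathbb{R}$, in particular uniform on $[0,1]$. 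-/

import Mathlib

open scoped Real Topology
open Set Filter MeasureTheory

/-- The Fourier coefficient `q_n = (q, e^{2πinx})` in `L₂[0,1]`, for `n ∈ ℤ`. -/
noncomputable def qCoeff (q : ℝ → ℂ) (n : ℤ) : ℂ :=
  ∫ x in (0 : ℝ)..1, q x * Complex.exp (-(2 * π * n * x * Complex.I))

/-- The class `L₁⁺[0,1]`: integrable on `[0,1]` with `q_n = 0` for `n = 0, -1, -2, …`.
Only the values of `q` on `[0,1]` play a role; outside `[0,1]` the potential is understood to be
continued with period `1`. -/
structure IsL1Plus (q : ℝ → ℂ) : Prop where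
  integrable : IntervalIntegrable q volume 0 1
  coeff_eq_zero : ∀ n : ℤ, n ≤ 0 → qCoeff q n = 0

/-- `ψ` restricted to `[0,1]` is an eigenfunction, with eigenvalue `lam`, of the operator `L_t(q)`
generated in `L₂[0,1]` by `-y'' + q y` and `y(1) = e^{it} y(0)`, `y'(1) = e^{it} y'(0)`:
`ψ` and `ψ'` are absolutely continuous on `[0,1]`, and `-ψ'' + q ψ = lam ψ` almost everywhere. -/
structure IsEigenfunction (q : ℝ → ℂ) (t lam : ℂ) (ψ : ℝ → ℂ) : Prop where
  differentiableOn : DifferentiableOn ℝ ψ (Icc 0 1)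
  absolutelyContinuous_deriv :
    AbsolutelyContinuousOnInterval (derivWithin ψ (Icc 0 1)) 0 1
  equation : ∀ᵐ x : ℝ, x ∈ Icc (0 : ℝ) 1 → ∃ w : ℂ,
    HasDerivAt (derivWithin ψ (Icc 0 1)) w x ∧ -w + q x * ψ x = lam * ψ x
  boundary : ψ 1 = Complex.exp (Complex.I * t) * ψ 0
  boundary_deriv :
    derivWithin ψ (Icc 0 1) 1 = Complex.exp (Complex.I * t) * derivWithin ψ (Icc 0 1) 0
  nonzero : ∃ x ∈ Icc (0 : ℝ) 1, ψ x ≠ 0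

/-- `ψ` is an eigenfunction of `L_t(q)` for the eigenvalue `(2πn+t)²`, normalized by
`(ψ, e^{i(2πn + conj t)x}) = 1` in `L₂[0,1]` and continued from `[0,1]` to the real line by
`ψ(x+1) = e^{it} ψ(x)`. -/
structure IsNormalizedBloch (q : ℝ → ℂ) (n : ℤ) (t : ℂ) (ψ : ℝ → ℂ) : Prop where
  eigenfunction : IsEigenfunction q t ((2 * π * n + t) ^ 2) ψ
  normalized : ∫ x in (0 : ℝ)..1, ψ x * (starRingEnd ℂ)
    (Complex.exp (Complex.I * (2 * π * n + (starRingEnd ℂ) t) * x)) = 1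
  quasiperiodic : ∀ x : ℝ, ψ (x + 1) = Complex.exp (Complex.I * t) * ψ x

/-- `t ∈ ℂ` is not an integer multiple of `π`. -/
def NotPiMultiple (t : ℂ) : Prop := ∀ k : ℤ, t ≠ π * k

/-- The Bloch function `Ψ_{n,t}` for `t ∉ πℤ`: the normalized eigenfunction of `L_t(q)` for the
eigenvalue `(2πn+t)²`. -/
noncomputable def blochFunction (q : ℝ → ℂ) (n : ℤ) (t : ℂ) : ℝ → ℂ :=
  Classical.epsilon (IsNormalizedBloch q n t)

/-- The `k`-tuples `(n_1, …, n_k)` of natural numbers with `n_1, …, n_k ≥ 1` and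
`p - n_1 - ⋯ - n_k ≥ 1`. -/
def tuples (k p : ℕ) : Finset (Fin k → ℕ) :=
  (Fintype.piFinset fun _ : Fin k => Finset.Icc 1 p).filter fun m => ∑ i, m i < p

/-- The partial sum `n(s) = n_1 + ⋯ + n_s`. -/
def partialSum {k : ℕ} (m : Fin k → ℕ) (s : Fin k) : ℕ := ∑ i ∈ Finset.Iic s, m i

/-- `d_{p,n}(t) = -(2πp(2π(2n+p)+2t))⁻¹`. -/
noncomputable def dCoeff (n : ℤ) (t : ℂ) (p : ℕ) : ℂ :=
  -(2 * π * p * (2 * π * (2 * n + p) + 2 * t))⁻¹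

/-- The coefficient `c_{p,n}(t)`, `p ≥ 1`, of the Bloch function. -/
noncomputable def cCoeff (q : ℝ → ℂ) (n : ℤ) (t : ℂ) (p : ℕ) : ℂ :=
  dCoeff n t p * (qCoeff q p + ∑ k ∈ Finset.Icc 1 (p - 1), ∑ m ∈ tuples k p,
    ((∏ i, qCoeff q (m i)) * qCoeff q ((p : ℤ) - ∑ i, (m i : ℤ))) /
      ∏ s, ((2 * π * (2 * n + p - partialSum m s) + 2 * t) * (2 * π * (partialSum m s - p))))

/-- The series `e^{i(2πn+t)x} + ∑_{p ≥ 1} c_{p,n}(t) e^{i(2π(n+p)+t)x}`. At `t = 0`, `n ≥ 1` and at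
`t = π`, `n ≥ 0`, where no denominator vanishes, it defines `Ψ_{n,0}` and `Ψ_{n,π}`. -/
noncomputable def blochSeries (q : ℝ → ℂ) (n : ℤ) (t : ℂ) (x : ℝ) : ℂ :=
  Complex.exp (Complex.I * (2 * π * n + t) * x) +
    ∑' j : ℕ, cCoeff q n t (j + 1) *
      Complex.exp (Complex.I * (2 * π * (n + (j + 1 : ℕ)) + t) * x)

/-- The generalized norming number `s_n`, `n ≥ 1`. -/
noncomputable def normingNumber (q : ℝ → ℂ) (n : ℕ) : ℂ :=
  qCoeff q n + ∑ k ∈ Finset.Icc 1 (n - 1), ∑ m ∈ tuples k n,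
    ((∏ i, qCoeff q (m i)) * qCoeff q ((n : ℤ) - ∑ i, (m i : ℤ))) /
      ∏ s, ((2 * π * partialSum m s) * (2 * π * (n - partialSum m s)))

/-! Only the quasi-momentum `σ = 2πn + t` matters: the boundary condition, the eigenvalue `σ²` and
the coefficients depend on `n` and `t` through it alone. Expanding a solution in the modes
`e^{i(2πm+σ)x}` turns the equation into `2πm(2πm+2σ) a_m = -∑_j q_{m-j} a_j`. Since `q_k = 0` for `k
≤ 0`, the sum runs over `j < m`, so the system is triangular. With `a_m = 0` for `m < 0` and `a_0 =
1` it determines every `a_p`, and unfolding the recursion gives the stated sums over compositions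
(`blochCoeff_rec`). The resulting series is `blochSum`.

For `σ ∉ πℤ` no factor with `m ≠ 0` vanishes. The series is then an eigenfunction
(`isEigenfunction_blochSum`), and it is the only normalized one, because the summable inverse
factors force the negative modes to vanish (`eq_zero_of_neg_of_triangular`,
`IsEigenfunction.eq_blochSum`).

The function `Ψ_{-n,-t}` has quasi-momentum `-πN + δ`, where `δ = t₀ - t` and `N` is `2n` or `2n+1`.
The only factor that degenerates is that of the mode `N`, which equals `4πNδ`. After multiplication
by `-4πNδ` the coefficients below `N` tend to `0`, and the one at `N` tends to `∑_{j<N} q_{N-j}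
u_j(-πN) = s_N`. Those above `N` obey the same recursion, which after the shift `p = N + r` is the
recursion at quasi-momentum `πN`; the limit is therefore `s_N` times the series at `πN`. A discrete
Gronwall inequality gives a summable bound uniform in `δ`, so the limit passes through the series,
jointly in `(δ, x)`. -/

/-! ### Twisted Fourier series -/

/-- The coefficient of `f` on `[0,1]` with respect to the mode `e^{i(2πm+σ)x}`. -/
noncomputable def twistedCoeff (σ : ℂ) (f : ℝ → ℂ) (m : ℤ) : ℂ :=
  ∫ x in (0 : ℝ)..1, f x * Complex.exp (-(Complex.I * (2 * π * m + σ) * x))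

theorem exp_two_pi_int_mul_I (m : ℤ) : Complex.exp (Complex.I * (2 * π * m)) = 1 := by
  rw [← Complex.exp_int_mul_two_pi_mul_I m]; ring_nf

/-- A quasi-periodic continuous function with summable coefficients is the sum of its
twisted Fourier series on `[0,1]`. -/
theorem hasSum_twistedCoeff {σ : ℂ} {f : ℝ → ℂ} (hf : ContinuousOn f (Icc 0 1))
    (hb : f 1 = Complex.exp (Complex.I * σ) * f 0) (hs : Summable (twistedCoeff σ f))
    {x : ℝ} (hx : x ∈ Icc (0 : ℝ) 1) :
    HasSum (fun m : ℤ => twistedCoeff σ f m * Complex.exp (Complex.I * (2 * π * m + σ) * x))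
      (f x) := by
  have : Fact ((0 : ℝ) < 1) := ⟨one_pos⟩
  -- Removing the factor `e^{iσx}` leaves a function with equal end values, hence a continuous
  -- function on the circle.
  set g : ℝ → ℂ := fun x => f x * Complex.exp (-(Complex.I * σ * x)) with hg
  have hg01 : g 0 = g 1 := by
    simp only [hg, hb]
    have : Complex.exp (Complex.I * σ) * Complex.exp (-(Complex.I * σ)) = 1 := by
      rw [← Complex.exp_add]; simp
    simp only [Complex.ofReal_zero, mul_zero, neg_zero, Complex.exp_zero, mul_one,
      Complex.ofReal_one]
    linear_combination (-f 0) * this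
  have hgc : ContinuousOn g (Icc 0 1) := by
    refine hf.mul (Continuous.continuousOn ?_)
    fun_prop
  let G : C(AddCircle (1 : ℝ), ℂ) :=
    ⟨AddCircle.liftIco 1 0 g, AddCircle.liftIco_zero_continuous hg01 hgc⟩
  have hcoef : fourierCoeff G = twistedCoeff σ f := by
    funext m
    change fourierCoeff (AddCircle.liftIco 1 0 g) m = _
    rw [fourierCoeff_liftIco_eq, fourierCoeffOn_eq_integral, twistedCoeff]
    simp only [zero_add, sub_zero, div_one, one_smul]
    refine intervalIntegral.integral_congr fun y _ => ?_
    simp only [hg, fourier_coe_apply, smul_eq_mul]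
    rw [mul_left_comm, ← Complex.exp_add]
    congr 2
    push_cast
    ring
  have key : ∀ y ∈ Icc (0 : ℝ) 1, G (y : AddCircle (1 : ℝ)) = g y := by
    intro y hy
    rcases eq_or_lt_of_le hy.2 with rfl | h1
    · have : ((1 : ℝ) : AddCircle (1 : ℝ)) = ((0 : ℝ) : AddCircle (1 : ℝ)) := by
        simp
      rw [this, ← hg01]
      exact AddCircle.liftIco_zero_coe_apply (p := (1 : ℝ)) (f := g) (x := 0) (by simp)
    · exact AddCircle.liftIco_zero_coe_apply (p := (1 : ℝ)) (f := g) ⟨hy.1, h1⟩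
  have h := has_pointwise_sum_fourier_series_of_summable (f := G) (by rwa [hcoef]) 
    ((x : ℝ) : AddCircle (1 : ℝ))
  rw [hcoef, key x hx] at h
  have h2 := h.mul_right (Complex.exp (Complex.I * σ * x))
  have e1 : g x * Complex.exp (Complex.I * σ * x) = f x := by
    simp only [hg]
    rw [mul_assoc, ← Complex.exp_add]
    simp
  rw [e1] at h2
  refine (congrArg (fun F => HasSum F (f x)) (funext fun m => ?_)).mp h2
  rw [smul_eq_mul, mul_assoc, fourier_coe_apply, ← Complex.exp_add]
  congr 2
  push_cast
  ring

/-! ### Absolute continuity and integration by parts -/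

/-- Increments of the primitive of `f` are dominated by those of the primitive of `‖f‖`, which
reduces the claim to the real-valued case. -/
theorem IntervalIntegrable.absolutelyContinuousOnInterval_primitive {f : ℝ → ℂ} {a b c : ℝ}
    (hf : IntervalIntegrable f volume a b) (hc : c ∈ uIcc a b) :
    AbsolutelyContinuousOnInterval (fun x => ∫ y in c..x, f y) a b := by
  have hn := hf.norm.absolutelyContinuousOnInterval_intervalIntegral hc
  have hsub : ∀ x ∈ uIcc a b, IntervalIntegrable f volume c x := fun x hx =>
    hf.mono_set (uIcc_subset_uIcc hc hx)
  refine squeeze_zero' (Eventually.of_forall fun _ => Finset.sum_nonneg fun _ _ => dist_nonneg)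
    ?_ hn
  rw [eventually_inf_principal]
  refine Eventually.of_forall fun E hE => Finset.sum_le_sum fun i hi => ?_
  have h1 := hsub _ (hE.1 i hi).1
  have h2 := hsub _ (hE.1 i hi).2
  rw [dist_comm, dist_comm (∫ y in c.._, ‖f y‖), dist_eq_norm, Real.dist_eq,
    intervalIntegral.integral_interval_sub_left h2 h1,
    intervalIntegral.integral_interval_sub_left h2.norm h1.norm]
  exact intervalIntegral.norm_integral_le_abs_integral_norm

/-- The difference between `fφ` and the primitive of its a.e. derivative is absolutely continuous
with derivative zero a.e., hence constant. -/
theorem AbsolutelyContinuousOnInterval.integral_mul_add_mul_eq_sub {f g φ φ' : ℝ → ℂ} {a b : ℝ}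
    (hf : AbsolutelyContinuousOnInterval f a b)
    (hfg : ∀ᵐ x, x ∈ uIcc a b → HasDerivAt f (g x) x) (hg : IntervalIntegrable g volume a b)
    (hφ : ∀ x, HasDerivAt φ (φ' x) x) (hφ' : Continuous φ') :
    (∫ x in a..b, (g x * φ x + f x * φ' x)) = f b * φ b - f a * φ a := by
  have hφc : Continuous φ := continuous_iff_continuousAt.2 fun x => (hφ x).continuousAt
  have hφ1 : ContDiff ℝ 1 φ := by
    rw [contDiff_one_iff_deriv]
    refine ⟨fun x => (hφ x).differentiableAt, ?_⟩
    have : deriv φ = φ' := funext fun x => (hφ x).deriv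
    rwa [this]
  have hi : IntervalIntegrable (fun x => g x * φ x + f x * φ' x) volume a b :=
    (hg.mul_continuousOn hφc.continuousOn).add
      (hf.continuousOn.mul hφ'.continuousOn).intervalIntegrable
  have hφa : AbsolutelyContinuousOnInterval φ a b := hφ1.contDiffOn.absolutelyContinuousOnInterval
  have hac1 : AbsolutelyContinuousOnInterval (fun x => f x • φ x) a b := hf.fun_smul hφa
  have hac2 : AbsolutelyContinuousOnInterval
      (fun x => ∫ y in a..x, (g y * φ y + f y * φ' y)) a b :=
    hi.absolutelyContinuousOnInterval_primitive left_mem_uIcc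
  have hac := hac1.sub hac2
  have hz : ∀ᵐ x, x ∈ uIcc a b → HasDerivAt
      ((fun x => f x • φ x) - fun x => ∫ y in a..x, (g y * φ y + f y * φ' y)) 0 x := by
    filter_upwards [hfg, hi.ae_hasDerivAt_integral] with x h1 h2 hx
    have h3 : HasDerivAt (fun x => f x • φ x) (g x * φ x + f x * φ' x) x := (h1 hx).fun_mul (hφ x)
    have h := h3.sub (h2 hx a (by simp))
    rwa [sub_self] at h
  obtain ⟨C, hC⟩ := hac.const_of_ae_hasDerivAt_zero hz
  have ha := hC a (by simp)
  have hb := hC b (by simp)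
  simp only [Pi.sub_apply, smul_eq_mul, intervalIntegral.integral_same] at ha hb
  linear_combination ha - hb

theorem hasDerivAt_exp_neg_mul (c : ℂ) (x : ℝ) :
    HasDerivAt (fun x : ℝ => Complex.exp (-(c * x))) (-c * Complex.exp (-(c * x))) x := by
  have h : HasDerivAt (fun x : ℝ => -(c * (x : ℂ))) (-(c * 1)) x :=
    ((Complex.ofRealCLM.hasDerivAt (x := x)).const_mul c).neg
  convert h.cexp using 1
  ring

/-- Twisted Fourier coefficients of the second derivative of a quasi-periodic function. -/
theorem twistedCoeff_second_deriv {σ : ℂ} {f v g : ℝ → ℂ}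
    (hf : ∀ x ∈ Icc (0 : ℝ) 1, HasDerivWithinAt f (v x) (Icc 0 1) x)
    (hv : AbsolutelyContinuousOnInterval v 0 1)
    (hvg : ∀ᵐ x : ℝ, x ∈ Icc (0 : ℝ) 1 → HasDerivAt v (g x) x)
    (hg : IntervalIntegrable g volume 0 1)
    (hf1 : f 1 = Complex.exp (Complex.I * σ) * f 0)
    (hv1 : v 1 = Complex.exp (Complex.I * σ) * v 0) (m : ℤ) :
    twistedCoeff σ g m = -(2 * π * m + σ) ^ 2 * twistedCoeff σ f m := by
  set c : ℂ := Complex.I * (2 * π * m + σ) with hc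
  have hvc : ContinuousOn v (uIcc 0 1) := hv.continuousOn
  have h01 : uIcc (0 : ℝ) 1 = Icc 0 1 := uIcc_of_le zero_le_one
  have hfc : ContinuousOn f (uIcc 0 1) := by
    rw [h01]; exact fun x hx => (hf x hx).continuousWithinAt
  have hφ := hasDerivAt_exp_neg_mul c
  have hφc : Continuous fun x : ℝ => Complex.exp (-(c * x)) := by fun_prop
  have hφ' : Continuous fun x : ℝ => -c * Complex.exp (-(c * x)) := by fun_prop
  -- This cancels the boundary terms in both integrations by parts.
  have hexp : Complex.exp (Complex.I * σ) * Complex.exp (-c) = 1 := by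
    have := exp_two_pi_int_mul_I (-m)
    rw [← Complex.exp_add, ← this, hc]
    congr 1; push_cast; ring
  have e1 := hv.integral_mul_add_mul_eq_sub (by rwa [h01]) hg hφ hφ'
  have e2 := intervalIntegral.integral_deriv_mul_eq_sub_of_hasDerivWithinAt
    (a := 0) (b := 1) (u := f) (u' := v) (by rwa [h01]) (fun x _ => (hφ x).hasDerivWithinAt)
    hvc.intervalIntegrable (hφ'.intervalIntegrable _ _)
  rw [intervalIntegral.integral_add (hg.mul_continuousOn hφc.continuousOn)
    (hvc.fun_mul hφ'.continuousOn).intervalIntegrable] at e1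
  rw [intervalIntegral.integral_add (hvc.fun_mul hφc.continuousOn).intervalIntegrable
    (hfc.fun_mul hφ'.continuousOn).intervalIntegrable] at e2
  have r : ∀ w : ℝ → ℂ, (∫ x in (0 : ℝ)..1, w x * (-c * Complex.exp (-(c * x)))) =
      -c * twistedCoeff σ w m := by
    intro w
    rw [twistedCoeff, ← intervalIntegral.integral_const_mul]
    exact intervalIntegral.integral_congr fun x _ => by simp only [hc]; ring
  rw [r] at e1 e2
  have e1' : twistedCoeff σ g m + -c * twistedCoeff σ v m = 0 := by
    rw [twistedCoeff, ← hc, e1, hv1]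
    simp only [Complex.ofReal_one, mul_one, Complex.ofReal_zero, mul_zero, neg_zero,
      Complex.exp_zero]
    linear_combination v 0 * hexp
  have e2' : twistedCoeff σ v m + -c * twistedCoeff σ f m = 0 := by
    rw [twistedCoeff, ← hc, e2, hf1]
    simp only [Complex.ofReal_one, mul_one, Complex.ofReal_zero, mul_zero, neg_zero,
      Complex.exp_zero]
    linear_combination f 0 * hexp
  have hc2 : c ^ 2 = -(2 * π * m + σ) ^ 2 := by rw [hc, mul_pow, Complex.I_sq]; ring
  rw [← hc2]
  linear_combination e1' + c * e2'

/-! ### Coefficient bounds and products as convolutions -/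

theorem norm_qCoeff_le (q : ℝ → ℂ) (n : ℤ) : ‖qCoeff q n‖ ≤ ∫ x in (0 : ℝ)..1, ‖q x‖ := by
  refine (intervalIntegral.norm_integral_le_integral_norm zero_le_one).trans_eq ?_
  refine intervalIntegral.integral_congr fun x _ => ?_
  have : -(2 * π * n * x * Complex.I : ℂ) = ((-(2 * π * n * x) : ℝ) : ℂ) * Complex.I := by
    push_cast; ring
  simp only [norm_mul, this, Complex.norm_exp_ofReal_mul_I, mul_one]

theorem qCoeff_const_one (n : ℤ) : qCoeff (fun _ => 1) n = if n = 0 then 1 else 0 := by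
  unfold qCoeff
  split_ifs with h
  · simp [h]
  · have hc : (-(2 * π * n * Complex.I) : ℂ) ≠ 0 := by
      simp [h, Real.pi_ne_zero]
    have h1 := integral_exp_mul_complex (a := 0) (b := 1) hc
    have h2 : Complex.exp (-(2 * π * n * Complex.I)) = 1 := by
      rw [← exp_two_pi_int_mul_I (-n)]; congr 1; push_cast; ring
    simp only [Complex.ofReal_one, mul_one, Complex.ofReal_zero, mul_zero, h2, Complex.exp_zero,
      sub_self, zero_div] at h1
    rw [← h1]
    refine intervalIntegral.integral_congr fun x _ => ?_
    simp only [one_mul]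
    congr 1; ring

theorem norm_exp_mode_le (σ : ℂ) (k : ℤ) (x : ℝ) :
    ‖Complex.exp (Complex.I * (2 * π * k + σ) * x)‖ ≤ Real.exp (‖σ‖ * |x|) := by
  rw [Complex.norm_exp]
  refine Real.exp_le_exp.2 ?_
  have : (Complex.I * (2 * π * k + σ) * x).re = -(σ.im * x) := by simp
  rw [this]
  refine (neg_le_abs _).trans ?_
  rw [abs_mul]
  exact mul_le_mul_of_nonneg_right (Complex.abs_im_le_norm σ) (abs_nonneg x)

/-- Termwise integration with dominating terms `‖a i‖ ‖h x‖`; integrability of `h` suffices, so this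
applies to the potential. With `h = 1` it reads off the coefficients of the series itself. -/
theorem hasSum_twistedCoeff_mul_tsum {ι : Type*} [Countable ι] {σ : ℂ} {h : ℝ → ℂ}
    (hh : IntervalIntegrable h volume 0 1) {a : ι → ℂ} (ha : Summable fun i => ‖a i‖)
    (k : ι → ℤ) (m : ℤ) :
    HasSum (fun i => a i * qCoeff h (m - k i)) (twistedCoeff σ
      (fun x => h x * ∑' i, a i * Complex.exp (Complex.I * (2 * π * k i + σ) * x)) m) := by
  have hterm : ∀ i x, h x * (a i * Complex.exp (Complex.I * (2 * π * k i + σ) * x)) *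
      Complex.exp (-(Complex.I * (2 * π * m + σ) * x)) =
      a i * (h x * Complex.exp (-(2 * π * (m - k i : ℤ) * x * Complex.I))) := by
    intro i x
    rw [show (-(2 * π * (m - k i : ℤ) * x * Complex.I) : ℂ) =
      Complex.I * (2 * π * k i + σ) * x + -(Complex.I * (2 * π * m + σ) * x) by push_cast; ring,
      Complex.exp_add]
    ring
  have hnorm : ∀ (n : ℤ) (x : ℝ), ‖Complex.exp (-(2 * π * n * x * Complex.I))‖ = 1 := by
    intro n x
    have : -(2 * π * n * x * Complex.I : ℂ) = ((-(2 * π * n * x) : ℝ) : ℂ) * Complex.I := by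
      push_cast; ring
    rw [this, Complex.norm_exp_ofReal_mul_I]
  have hint : ∀ i, (∫ x in (0 : ℝ)..1,
      a i * (h x * Complex.exp (-(2 * π * (m - k i : ℤ) * x * Complex.I)))) =
      a i * qCoeff h (m - k i) := fun i => intervalIntegral.integral_const_mul _ _
  simp_rw [← hint]
  refine intervalIntegral.hasSum_integral_of_dominated_convergence
    (fun i x => ‖a i‖ * ‖h x‖) (fun i => ?_) (fun i => ?_) ?_ ?_ ?_
  · refine (AEStronglyMeasurable.mul ?_ ?_).const_mul _
    · exact hh.def'.aestronglyMeasurable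
    · exact (Continuous.aestronglyMeasurable (by fun_prop))
  · exact ae_of_all _ fun x _ => by rw [norm_mul, norm_mul, hnorm, mul_one]
  · exact ae_of_all _ fun x _ => ha.mul_right _
  · simp_rw [tsum_mul_right]
    exact hh.norm.const_mul _
  · refine ae_of_all _ fun x _ => ?_
    simp_rw [← hterm]
    refine (Summable.hasSum ?_).mul_left _ |>.mul_right _
    refine Summable.of_norm_bounded (ha.mul_right (Real.exp (‖σ‖ * |x|))) fun i => ?_
    rw [norm_mul]
    exact mul_le_mul_of_nonneg_left (norm_exp_mode_le σ (k i) x) (norm_nonneg _)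

/-! ### Sums over compositions and the triangular recursion -/

theorem mem_tuples {k p : ℕ} {m : Fin k → ℕ} :
    m ∈ tuples k p ↔ (∀ i, 1 ≤ m i) ∧ ∑ i, m i < p := by
  simp only [tuples, Finset.mem_filter, Fintype.mem_piFinset, Finset.mem_Icc]
  refine ⟨fun h => ⟨fun i => (h.1 i).1, h.2⟩, fun h => ⟨fun i => ⟨h.1 i, ?_⟩, h.2⟩⟩
  exact (Finset.single_le_sum (fun _ _ => Nat.zero_le _) (Finset.mem_univ i)).trans h.2.le

theorem partialSum_eq {k : ℕ} (m : Fin k → ℕ) (s : Fin k) :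
    partialSum m s = ∑ i, if i ≤ s then m i else 0 := by
  rw [partialSum, ← Finset.sum_filter]
  congr 1
  ext i
  simp

theorem partialSum_cons_zero {k : ℕ} (j : ℕ) (m : Fin k → ℕ) :
    partialSum (Fin.cons j m : Fin (k + 1) → ℕ) 0 = j := by
  rw [partialSum_eq, Fin.sum_univ_succ]
  simp

theorem partialSum_cons_succ {k : ℕ} (j : ℕ) (m : Fin k → ℕ) (s : Fin k) :
    partialSum (Fin.cons j m : Fin (k + 1) → ℕ) s.succ = j + partialSum m s := by
  rw [partialSum_eq, Fin.sum_univ_succ, partialSum_eq]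
  simp

theorem partialSum_le {k : ℕ} (m : Fin k → ℕ) (s : Fin k) : partialSum m s ≤ ∑ i, m i :=
  Finset.sum_le_sum_of_subset (Finset.subset_univ _)

/-- The sum over the compositions of `p` into `k + 1` positive parts, each part weighted by `c` and
each proper remainder by `e`. -/
noncomputable def compositionSum (c e : ℕ → ℂ) (k p : ℕ) : ℂ :=
  ∑ m ∈ tuples k p, (∏ i, c (m i)) * c (p - ∑ i, m i) * ∏ s, e (p - partialSum m s)

theorem compositionSum_zero (c e : ℕ → ℂ) {p : ℕ} (hp : 1 ≤ p) :
    compositionSum c e 0 p = c p := by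
  have : tuples 0 p = {Fin.elim0} := by
    ext m
    rw [mem_tuples, Finset.mem_singleton]
    exact ⟨fun _ => Subsingleton.elim _ _, fun _ => ⟨fun i => i.elim0, by simpa [Nat.pos_iff_ne_zero, Nat.one_le_iff_ne_zero] using hp⟩⟩
  simp [compositionSum, this]

theorem compositionSum_eq_zero (c e : ℕ → ℂ) {k p : ℕ} (h : p ≤ k) :
    compositionSum c e k p = 0 := by
  refine Finset.sum_eq_zero fun m hm => ?_
  rw [mem_tuples] at hm
  have : ∑ _i : Fin k, 1 ≤ ∑ i, m i := Finset.sum_le_sum fun i _ => hm.1 i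
  simp only [Finset.sum_const, Finset.card_univ, Fintype.card_fin, smul_eq_mul, mul_one] at this
  omega

/-- Split off the first part `j`: what remains is a composition of `p - j`, and `p - j` is the first
proper remainder. -/
theorem compositionSum_succ (c e : ℕ → ℂ) (k p : ℕ) :
    compositionSum c e (k + 1) p =
      ∑ j ∈ Finset.Icc 1 (p - 1), c j * (e (p - j) * compositionSum c e k (p - j)) := by
  simp only [compositionSum, Finset.mul_sum]
  rw [Finset.sum_sigma']
  refine Finset.sum_nbij' (fun m => ⟨m 0, Fin.tail m⟩) (fun x => Fin.cons x.1 x.2) ?_ ?_ ?_ ?_ ?_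
  · intro m hm
    rw [mem_tuples, Fin.sum_univ_succ] at hm
    simp only [Finset.mem_sigma, Finset.mem_Icc, mem_tuples, Fin.tail]
    have := hm.1 0
    refine ⟨⟨this, by omega⟩, fun i => hm.1 _, by omega⟩
  · rintro ⟨j, m⟩ h
    simp only [Finset.mem_sigma, Finset.mem_Icc, mem_tuples] at h
    rw [mem_tuples, Fin.sum_univ_succ]
    simp only [Fin.cons_zero, Fin.cons_succ]
    refine ⟨fun i => ?_, by omega⟩
    refine Fin.cases ?_ (fun i => ?_) i
    · exact h.1.1
    · exact h.2.1 i
  · intro m _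
    exact Fin.cons_self_tail m
  · rintro ⟨j, m⟩ _
    simp
  · intro m hm
    obtain ⟨j, m, rfl⟩ : ∃ j m', m = Fin.cons j m' := ⟨m 0, Fin.tail m, (Fin.cons_self_tail m).symm⟩
    simp only [Fin.prod_univ_succ, Fin.sum_univ_succ, Fin.cons_zero, Fin.cons_succ, Fin.tail_cons,
      partialSum_cons_zero, partialSum_cons_succ, Nat.sub_add_eq]
    ring

theorem sum_compositionSum_eq (c e : ℕ → ℂ) {p N : ℕ} (h : p ≤ N) :
    ∑ k ∈ Finset.range N, compositionSum c e k p =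
      ∑ k ∈ Finset.range p, compositionSum c e k p := by
  refine (Finset.sum_subset (Finset.range_mono h) fun k _ hk => ?_).symm
  exact compositionSum_eq_zero c e (by simpa using hk)

theorem sum_compositionSum_rec (c e : ℕ → ℂ) {p : ℕ} (hp : 1 ≤ p) :
    ∑ k ∈ Finset.range p, compositionSum c e k p = c p + ∑ j ∈ Finset.Icc 1 (p - 1),
      c j * (e (p - j) * ∑ k ∈ Finset.range (p - j), compositionSum c e k (p - j)) := by
  obtain ⟨p, rfl⟩ : ∃ r, p = r + 1 := ⟨p - 1, by omega⟩
  rw [Finset.sum_range_succ', compositionSum_zero c e hp, add_comm]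
  congr 1
  simp only [compositionSum_succ]
  rw [Finset.sum_comm]
  refine Finset.sum_congr rfl fun j hj => ?_
  rw [Finset.mem_Icc] at hj
  rw [← sum_compositionSum_eq c e (p := p + 1 - j) (N := p) (by omega), Finset.mul_sum,
    Finset.mul_sum]

theorem add_sum_compositionSum (c e : ℕ → ℂ) {p : ℕ} (hp : 1 ≤ p) :
    c p + ∑ k ∈ Finset.Icc 1 (p - 1), compositionSum c e k p =
      ∑ k ∈ Finset.range p, compositionSum c e k p := by
  obtain ⟨p, rfl⟩ : ∃ r, p = r + 1 := ⟨p - 1, by omega⟩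
  rw [Finset.sum_range_succ', compositionSum_zero c e hp, add_comm]
  congr 1
  rw [Nat.add_sub_cancel, ← Finset.sum_image (g := fun k => k + 1)
    (f := fun k => compositionSum c e k (p + 1)) (by simp)]
  congr 1
  ext k
  simp only [Finset.mem_Icc, Finset.mem_image, Finset.mem_range]
  exact ⟨fun h => ⟨k - 1, by omega, by omega⟩, by rintro ⟨a, h, rfl⟩; omega⟩

theorem sum_tuples_div_eq_compositionSum (q : ℝ → ℂ) (f : ℕ → ℂ) (e : ℕ → ℂ) (k p : ℕ)
    (h : ∀ r, r < p → (f r)⁻¹ = e (p - r)) :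
    (∑ m ∈ tuples k p, ((∏ i, qCoeff q (m i)) * qCoeff q ((p : ℤ) - ∑ i, (m i : ℤ))) /
      ∏ s, f (partialSum m s)) = compositionSum (fun j => qCoeff q j) e k p := by
  refine Finset.sum_congr rfl fun m hm => ?_
  rw [mem_tuples] at hm
  rw [div_eq_mul_inv, ← Finset.prod_inv_distrib]
  congr 1
  · push_cast [Nat.cast_sub hm.2.le]; rfl
  · refine Finset.prod_congr rfl fun s _ => h _ ((partialSum_le m s).trans_lt hm.2)

theorem cCoeff_eq_compositionSum (q : ℝ → ℂ) (n : ℤ) (t : ℂ) {p : ℕ} (hp : 1 ≤ p) :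
    cCoeff q n t p = dCoeff n t p *
      ∑ k ∈ Finset.range p, compositionSum (fun j => qCoeff q j) (dCoeff n t) k p := by
  rw [cCoeff, ← add_sum_compositionSum _ _ hp]
  congr 2
  refine Finset.sum_congr rfl fun k _ => ?_
  refine sum_tuples_div_eq_compositionSum q
    (fun r => (2 * π * (2 * n + p - r) + 2 * t) * (2 * π * (r - p))) _ k p fun r hr => ?_
  rw [dCoeff, ← inv_neg, Nat.cast_sub hr.le]
  congr 1; ring

/-- At quasi-momentum `-πN` the weight of the remainder `N - r` is `1/(2πr · 2π(N-r))`. Hence `s_N`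
is the sum in the coefficient of the mode `N` without its singular prefactor. -/
theorem normingNumber_eq_compositionSum (q : ℝ → ℂ) {n : ℤ} {t : ℂ} {N : ℕ} (hN : 1 ≤ N)
    (h : 2 * π * n + t = -(π * N)) :
    normingNumber q N =
      ∑ k ∈ Finset.range N, compositionSum (fun j => qCoeff q j) (dCoeff n t) k N := by
  rw [normingNumber, ← add_sum_compositionSum _ _ hN]
  congr 1
  refine Finset.sum_congr rfl fun k _ => ?_
  push_cast
  refine sum_tuples_div_eq_compositionSum q
    (fun r => (2 * π * r) * (2 * π * (N - r))) _ k N fun r hr => ?_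
  rw [dCoeff, ← inv_neg, Nat.cast_sub hr.le]
  congr 1
  linear_combination (4 * π * (N - r)) * h

theorem dCoeff_eq (n : ℤ) (t : ℂ) : dCoeff n t = dCoeff 0 (2 * π * n + t) := by
  funext p
  simp only [dCoeff]
  congr 2
  push_cast
  ring

theorem cCoeff_eq (q : ℝ → ℂ) (n : ℤ) (t : ℂ) (p : ℕ) :
    cCoeff q n t p = cCoeff q 0 (2 * π * n + t) p := by
  rcases Nat.eq_zero_or_pos p with rfl | hp
  · simp [cCoeff, dCoeff]
  · rw [cCoeff_eq_compositionSum q n t hp, cCoeff_eq_compositionSum q 0 _ hp, dCoeff_eq]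

/-- The coefficients of the Bloch function with quasi-momentum `σ`, including the leading `1`. -/
noncomputable def blochCoeff (q : ℝ → ℂ) (σ : ℂ) (p : ℕ) : ℂ :=
  if p = 0 then 1 else cCoeff q 0 σ p

@[simp]
theorem blochCoeff_zero (q : ℝ → ℂ) (σ : ℂ) : blochCoeff q σ 0 = 1 := by simp [blochCoeff]

theorem sum_compositionSum_eq_convolution (q : ℝ → ℂ) (σ : ℂ) {p : ℕ} (hp : 1 ≤ p) :
    ∑ k ∈ Finset.range p, compositionSum (fun j => qCoeff q j) (dCoeff 0 σ) k p =
      ∑ j ∈ Finset.range p, qCoeff q (p - j : ℕ) * blochCoeff q σ j := by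
  rw [sum_compositionSum_rec _ _ hp]
  obtain ⟨p, rfl⟩ : ∃ r, p = r + 1 := ⟨p - 1, by omega⟩
  rw [Finset.sum_range_succ', blochCoeff_zero, mul_one, Nat.sub_zero, add_comm]
  congr 1
  refine Finset.sum_nbij' (fun j => p - j) (fun j => p - j) ?_ ?_ ?_ ?_ ?_
  · intro j hj; simp only [Finset.mem_Icc, Finset.mem_range] at *; omega
  · intro j hj; simp only [Finset.mem_Icc, Finset.mem_range] at *; omega
  · intro j hj; simp only [Finset.mem_Icc] at *; omega
  · intro j hj; simp only [Finset.mem_range] at *; omega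
  · intro j hj
    simp only [Finset.mem_Icc] at hj
    have h1 : p + 1 - (p - j + 1) = j := by omega
    have h2 : p - j + 1 = p + 1 - j := by omega
    rw [h1, h2, blochCoeff, if_neg (by omega), cCoeff_eq_compositionSum q 0 σ (by omega)]

theorem blochCoeff_rec (q : ℝ → ℂ) (σ : ℂ) {p : ℕ} (hp : 1 ≤ p) :
    blochCoeff q σ p =
      dCoeff 0 σ p * ∑ j ∈ Finset.range p, qCoeff q (p - j : ℕ) * blochCoeff q σ j := by
  rw [← sum_compositionSum_eq_convolution q σ hp, blochCoeff, if_neg (by omega),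
    cCoeff_eq_compositionSum q 0 σ hp]

/-- Only indices `j < N` occur, so the degenerate weight at index `N` never enters. -/
theorem normingNumber_eq_convolution (q : ℝ → ℂ) {N : ℕ} (hN : 1 ≤ N) :
    normingNumber q N =
      ∑ j ∈ Finset.range N, qCoeff q (N - j : ℕ) * blochCoeff q (-(π * N)) j := by
  rw [← sum_compositionSum_eq_convolution q _ hN]
  exact normingNumber_eq_compositionSum q hN (by simp)

/-! ### Discrete Gronwall inequality and summability -/

/-- Discrete Gronwall: from `N` on, each new term multiplies the partial sum by at most `1 + w p ≤
exp (w p)`. -/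
theorem sum_range_le_mul_exp_tsum {a w : ℕ → ℝ} (ha : ∀ p, 0 ≤ a p) (hw : ∀ p, 0 ≤ w p)
    (hs : Summable w) {N : ℕ} (h : ∀ p, N ≤ p → a p ≤ w p * ∑ j ∈ Finset.range p, a j) (p : ℕ) :
    ∑ j ∈ Finset.range p, a j ≤ (∑ j ∈ Finset.range N, a j) * Real.exp (∑' j, w j) := by
  have hA : ∀ p, 0 ≤ ∑ j ∈ Finset.range p, a j := fun p => Finset.sum_nonneg fun j _ => ha j
  have key : ∀ r, ∑ j ∈ Finset.range (N + r), a j ≤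
      (∑ j ∈ Finset.range N, a j) * Real.exp (∑ j ∈ Finset.range (N + r), w j) := by
    intro r
    induction r with
    | zero =>
      exact le_mul_of_one_le_right (hA _) (Real.one_le_exp (Finset.sum_nonneg fun j _ => hw j))
    | succ r ih =>
      rw [← add_assoc, Finset.sum_range_succ, Finset.sum_range_succ, Real.exp_add, ← mul_assoc]
      have h1 := h (N + r) (by omega)
      have h2 := Real.add_one_le_exp (w (N + r))
      calc _ ≤ (∑ j ∈ Finset.range (N + r), a j) * (w (N + r) + 1) := by linarith
        _ ≤ _ := mul_le_mul ih h2 (by linarith [hw (N + r)])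
          (mul_nonneg (hA _) (Real.exp_pos _).le)
  calc ∑ j ∈ Finset.range p, a j ≤ ∑ j ∈ Finset.range (N + p), a j :=
        Finset.sum_le_sum_of_subset_of_nonneg (Finset.range_mono (by omega)) fun j _ _ => ha j
    _ ≤ _ := key p
    _ ≤ _ := mul_le_mul_of_nonneg_left
        (Real.exp_le_exp.2 (hs.sum_le_tsum _ fun j _ => hw j)) (hA N)

/-- The product of inverses is at most the sum of their squares, and both squares are summable over
`ℤ`. A vanishing factor contributes `0⁻¹ = 0`, so no restriction on `σ` is needed. -/
theorem summable_norm_inv_mul_add (σ : ℂ) :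
    Summable fun m : ℤ => ‖((2 * π * m * (2 * π * m + 2 * σ))⁻¹ : ℂ)‖ := by
  have h1 := (EisensteinSeries.linear_right_summable 0 0 (k := 2) le_rfl).norm
  have h2 := (EisensteinSeries.linear_right_summable (σ / π) 1 (k := 2) le_rfl).norm
  refine Summable.of_nonneg_of_le (fun _ => norm_nonneg _) (fun m => ?_) (h1.add h2)
  have hpi : (π : ℂ) ≠ 0 := by simp [Real.pi_ne_zero]
  have e : ((2 * π * m * (2 * π * m + 2 * σ))⁻¹ : ℂ) =
      (4 * π ^ 2 : ℂ)⁻¹ * ((m : ℂ)⁻¹ * (σ / π + m)⁻¹) := by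
    rw [← mul_inv, ← mul_inv]
    congr 1
    field_simp
    ring
  have h4 : ‖(4 * π ^ 2 : ℂ)⁻¹‖ ≤ 1 := by
    rw [norm_inv]
    refine inv_le_one_of_one_le₀ ?_
    simp only [norm_mul, norm_pow, Complex.norm_real, Real.norm_eq_abs, abs_of_pos Real.pi_pos]
    norm_num
    nlinarith [Real.pi_gt_three]
  rw [e, norm_mul]
  refine (mul_le_of_le_one_left (norm_nonneg _) h4).trans ?_
  simp only [Int.cast_zero, zero_mul, zero_add, Int.cast_one, one_mul, norm_mul, norm_inv,
    norm_pow, zpow_ofNat, ← inv_pow]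
  nlinarith [sq_nonneg (‖(m : ℂ)‖⁻¹ - ‖σ / π + m‖⁻¹), sq_nonneg (‖(m : ℂ)‖⁻¹),
    sq_nonneg (‖σ / π + m‖⁻¹)]

theorem norm_dCoeff_zero (σ : ℂ) (p : ℕ) : ‖dCoeff 0 σ p‖ =
    ‖((2 * π * (p : ℤ) * (2 * π * (p : ℤ) + 2 * σ))⁻¹ : ℂ)‖ := by
  simp [dCoeff]

theorem summable_norm_dCoeff (σ : ℂ) : Summable fun p : ℕ => ‖dCoeff 0 σ p‖ := by
  simp_rw [norm_dCoeff_zero]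
  exact (summable_norm_inv_mul_add σ).comp_injective Nat.cast_injective

theorem norm_convolution_le (q : ℝ → ℂ) (a : ℕ → ℂ) (p : ℕ) :
    ‖∑ j ∈ Finset.range p, qCoeff q (p - j : ℕ) * a j‖ ≤
      (∫ x in (0 : ℝ)..1, ‖q x‖) * ∑ j ∈ Finset.range p, ‖a j‖ := by
  rw [Finset.mul_sum]
  refine (norm_sum_le _ _).trans (Finset.sum_le_sum fun j _ => ?_)
  rw [norm_mul]
  exact mul_le_mul_of_nonneg_right (norm_qCoeff_le q _) (norm_nonneg _)

theorem integral_norm_nonneg (q : ℝ → ℂ) : 0 ≤ ∫ x in (0 : ℝ)..1, ‖q x‖ :=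
  intervalIntegral.integral_nonneg zero_le_one fun _ _ => norm_nonneg _

theorem summable_norm_blochCoeff (q : ℝ → ℂ) (σ : ℂ) : Summable fun p => ‖blochCoeff q σ p‖ := by
  set Q := ∫ x in (0 : ℝ)..1, ‖q x‖
  have hQ : 0 ≤ Q := integral_norm_nonneg q
  refine summable_of_sum_range_le (fun p => norm_nonneg _)
    (sum_range_le_mul_exp_tsum (N := 1) (w := fun p => ‖dCoeff 0 σ p‖ * Q)
      (fun p => norm_nonneg _) (fun p => by positivity) ((summable_norm_dCoeff σ).mul_right Q)
      fun p hp => ?_)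
  rw [blochCoeff_rec q σ hp, norm_mul, mul_assoc]
  exact mul_le_mul_of_nonneg_left (norm_convolution_le q _ p) (norm_nonneg _)

/-! ### The Bloch series and its Fourier coefficients -/

/-- The Bloch function `∑_{p ≥ 0} u_p e^{i(2πp+σ)x}` with quasi-momentum `σ`. -/
noncomputable def blochSum (q : ℝ → ℂ) (σ : ℂ) (x : ℝ) : ℂ :=
  ∑' p : ℕ, blochCoeff q σ p * Complex.exp (Complex.I * (2 * π * (p : ℤ) + σ) * x)

theorem norm_mode_le (a σ : ℂ) (k : ℤ) {x R : ℝ} (hx : |x| ≤ R) :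
    ‖a * Complex.exp (Complex.I * (2 * π * k + σ) * x)‖ ≤ ‖a‖ * Real.exp (‖σ‖ * R) := by
  rw [norm_mul]
  refine mul_le_mul_of_nonneg_left ((norm_exp_mode_le σ k x).trans ?_) (norm_nonneg _)
  exact Real.exp_le_exp.2 (mul_le_mul_of_nonneg_left hx (norm_nonneg _))

theorem continuous_blochSum (q : ℝ → ℂ) (σ : ℂ) : Continuous (blochSum q σ) := by
  refine continuous_iff_continuousAt.2 fun x₀ => ?_
  refine tendsto_tsum_of_dominated_convergence
    (bound := fun p => ‖blochCoeff q σ p‖ * Real.exp (‖σ‖ * (|x₀| + 1)))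
    ((summable_norm_blochCoeff q σ).mul_right _)
    (fun p => Continuous.tendsto (by fun_prop) x₀) ?_
  filter_upwards [continuous_abs.continuousAt.eventually_lt_const (lt_add_one |x₀|)] with x hx p
  exact norm_mode_le _ _ _ hx.le

theorem continuousOn_blochSum (q : ℝ → ℂ) (σ : ℂ) : ContinuousOn (blochSum q σ) (Icc 0 1) :=
  (continuous_blochSum q σ).continuousOn

theorem blochSum_add_one (q : ℝ → ℂ) (σ : ℂ) (x : ℝ) :
    blochSum q σ (x + 1) = Complex.exp (Complex.I * σ) * blochSum q σ x := by
  rw [blochSum, blochSum, ← tsum_mul_left]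
  refine tsum_congr fun p => ?_
  have : Complex.I * (2 * π * (p : ℤ) + σ) * ((x + 1 : ℝ) : ℂ) =
      Complex.I * σ + Complex.I * (2 * π * (p : ℤ) + σ) * x + Complex.I * (2 * π * (p : ℤ)) := by
    push_cast; ring
  rw [this, Complex.exp_add, Complex.exp_add, exp_two_pi_int_mul_I]
  ring

theorem hasSum_twistedCoeff_mul_blochSum (q : ℝ → ℂ) (σ : ℂ) {h : ℝ → ℂ}
    (hh : IntervalIntegrable h volume 0 1) (m : ℤ) :
    HasSum (fun p : ℕ => blochCoeff q σ p * qCoeff h (m - p))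
      (twistedCoeff σ (fun x => h x * blochSum q σ x) m) :=
  hasSum_twistedCoeff_mul_tsum hh (summable_norm_blochCoeff q σ) (fun p : ℕ => (p : ℤ)) m

theorem twistedCoeff_blochSum_natCast (q : ℝ → ℂ) (σ : ℂ) (p : ℕ) :
    twistedCoeff σ (blochSum q σ) p = blochCoeff q σ p := by
  have h := hasSum_twistedCoeff_mul_blochSum q σ (h := fun _ => 1) intervalIntegrable_const p
  simp only [one_mul] at h
  refine h.unique ?_
  have h2 := hasSum_single (f := fun j : ℕ => blochCoeff q σ j * qCoeff (fun _ => 1) (p - j)) p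
    fun j hj => by rw [qCoeff_const_one, if_neg (by omega), mul_zero]
  simpa [qCoeff_const_one] using h2

theorem twistedCoeff_blochSum_of_neg (q : ℝ → ℂ) (σ : ℂ) {m : ℤ} (hm : m < 0) :
    twistedCoeff σ (blochSum q σ) m = 0 := by
  have h := hasSum_twistedCoeff_mul_blochSum q σ (h := fun _ => 1) intervalIntegrable_const m
  simp only [one_mul] at h
  refine h.unique ?_
  convert hasSum_zero with j
  rw [qCoeff_const_one, if_neg (by omega), mul_zero]

theorem twistedCoeff_mul_blochSum_natCast {q : ℝ → ℂ} (hq : IsL1Plus q) (σ : ℂ) (p : ℕ) :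
    twistedCoeff σ (fun x => q x * blochSum q σ x) p =
      ∑ j ∈ Finset.range p, qCoeff q (p - j : ℕ) * blochCoeff q σ j := by
  rw [← (hasSum_twistedCoeff_mul_blochSum q σ hq.integrable p).tsum_eq,
    tsum_eq_sum (s := Finset.range p)]
  · refine Finset.sum_congr rfl fun j hj => ?_
    rw [Finset.mem_range] at hj
    rw [mul_comm, Nat.cast_sub hj.le]
  · intro j hj
    rw [Finset.mem_range] at hj
    rw [hq.coeff_eq_zero _ (by omega), mul_zero]

theorem twistedCoeff_mul_blochSum_of_neg {q : ℝ → ℂ} (hq : IsL1Plus q) (σ : ℂ) {m : ℤ}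
    (hm : m < 0) : twistedCoeff σ (fun x => q x * blochSum q σ x) m = 0 := by
  refine (hasSum_twistedCoeff_mul_blochSum q σ hq.integrable m).unique ?_
  convert hasSum_zero with j
  rw [hq.coeff_eq_zero _ (by omega), mul_zero]

theorem intervalIntegrable_mul_mode {g : ℝ → ℂ} (hg : IntervalIntegrable g volume 0 1) (c : ℂ) :
    IntervalIntegrable (fun x => g x * Complex.exp (-(c * x))) volume 0 1 :=
  hg.mul_continuousOn (Continuous.continuousOn (by fun_prop))

theorem twistedCoeff_sub {σ : ℂ} {f g : ℝ → ℂ} (hf : IntervalIntegrable f volume 0 1)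
    (hg : IntervalIntegrable g volume 0 1) (m : ℤ) :
    twistedCoeff σ (fun x => f x - g x) m = twistedCoeff σ f m - twistedCoeff σ g m := by
  simp only [twistedCoeff]
  rw [← intervalIntegral.integral_sub (intervalIntegrable_mul_mode hf _)
    (intervalIntegrable_mul_mode hg _)]
  simp only [sub_mul]

theorem twistedCoeff_const_mul (σ c : ℂ) (f : ℝ → ℂ) (m : ℤ) :
    twistedCoeff σ (fun x => c * f x) m = c * twistedCoeff σ f m := by
  simp only [twistedCoeff]
  rw [← intervalIntegral.integral_const_mul]
  simp only [mul_assoc]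

theorem twistedCoeff_congr {σ : ℂ} {f g : ℝ → ℂ} (h : ∀ x ∈ Ioc (0 : ℝ) 1, f x = g x) (m : ℤ) :
    twistedCoeff σ f m = twistedCoeff σ g m := by
  refine intervalIntegral.integral_congr_ae (ae_of_all _ fun x hx => ?_)
  rw [uIoc_of_le zero_le_one] at hx
  rw [h x hx]

/-! ### Existence: the series is an eigenfunction -/

theorem two_pi_int_add_ne_zero {σ : ℂ} (hσ : NotPiMultiple σ) (m : ℤ) : 2 * π * m + σ ≠ 0 := by
  intro h
  refine hσ (-2 * m) ?_
  push_cast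
  linear_combination h

theorem two_pi_int_add_two_mul_ne_zero {σ : ℂ} (hσ : NotPiMultiple σ) (m : ℤ) :
    2 * π * m + 2 * σ ≠ 0 := by
  intro h
  refine hσ (-m) ?_
  push_cast
  linear_combination h / 2

theorem eigen_factor_ne_zero {σ : ℂ} (hσ : NotPiMultiple σ) {m : ℤ} (hm : m ≠ 0) :
    2 * π * m * (2 * π * m + 2 * σ) ≠ 0 := by
  refine mul_ne_zero ?_ (two_pi_int_add_two_mul_ne_zero hσ m)
  simp [hm, Real.pi_ne_zero]

theorem exp_I_mul_ne_one {σ : ℂ} (hσ : NotPiMultiple σ) : Complex.exp (Complex.I * σ) ≠ 1 := by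
  intro h
  obtain ⟨n, hn⟩ := Complex.exp_eq_one_iff.1 h
  refine hσ (2 * n) ?_
  have : Complex.I * σ = Complex.I * (2 * n * π) := by rw [hn]; ring
  rw [mul_left_cancel₀ Complex.I_ne_zero this]
  push_cast; ring

theorem intervalIntegrable_potential_mul {q f : ℝ → ℂ} (hq : IntervalIntegrable q volume 0 1)
    (hf : ContinuousOn f (Icc 0 1)) (c : ℂ) :
    IntervalIntegrable (fun x => q x * f x - c * f x) volume 0 1 := by
  have hf' : ContinuousOn f (uIcc 0 1) := by rwa [uIcc_of_le zero_le_one]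
  exact (hq.mul_continuousOn hf').sub (hf'.intervalIntegrable.const_mul c)

theorem twistedCoeff_potential_mul {q f : ℝ → ℂ} (hq : IntervalIntegrable q volume 0 1)
    (hf : ContinuousOn f (Icc 0 1)) (σ c : ℂ) (m : ℤ) :
    twistedCoeff σ (fun x => q x * f x - c * f x) m =
      twistedCoeff σ (fun x => q x * f x) m - c * twistedCoeff σ f m := by
  have hf' : ContinuousOn f (uIcc 0 1) := by rwa [uIcc_of_le zero_le_one]
  rw [twistedCoeff_sub (hq.mul_continuousOn hf') (hf'.intervalIntegrable.const_mul c),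
    twistedCoeff_const_mul]

/-- This is `y'' = (q - σ²) y` on the Fourier side, before any differentiability of the series is
known. -/
theorem twistedCoeff_potential_mul_blochSum {q : ℝ → ℂ} (hq : IsL1Plus q) {σ : ℂ}
    (hσ : NotPiMultiple σ) (m : ℤ) :
    twistedCoeff σ (fun x => q x * blochSum q σ x - σ ^ 2 * blochSum q σ x) m =
      -(2 * π * m + σ) ^ 2 * twistedCoeff σ (blochSum q σ) m := by
  rw [twistedCoeff_potential_mul hq.integrable (continuousOn_blochSum q σ)]
  rcases lt_or_ge m 0 with hm | hm
  · rw [twistedCoeff_mul_blochSum_of_neg hq σ hm, twistedCoeff_blochSum_of_neg q σ hm]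
    ring
  · lift m to ℕ using hm
    rw [twistedCoeff_mul_blochSum_natCast hq, twistedCoeff_blochSum_natCast]
    rcases Nat.eq_zero_or_pos m with rfl | hp
    · simp
    · have h1 := blochCoeff_rec q σ hp
      have h2 := eigen_factor_ne_zero hσ (m := m) (by omega)
      have h3 : dCoeff 0 σ m = -(2 * π * (m : ℤ) * (2 * π * (m : ℤ) + 2 * σ))⁻¹ := by
        simp [dCoeff]
      rw [h3] at h1
      have h4 : (2 * π * (m : ℤ) * (2 * π * (m : ℤ) + 2 * σ)) * blochCoeff q σ m =
          -∑ j ∈ Finset.range m, qCoeff q (m - j : ℕ) * blochCoeff q σ j := by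
        conv_lhs => rw [h1]
        rw [neg_mul, mul_neg, mul_inv_cancel_left₀ h2]
      linear_combination h4

/-- Solution of `y'' = g` on `[0,1]` with quasi-periodic boundary conditions. -/
theorem exists_quasiperiodic_primitive {σ : ℂ} (hσ : Complex.exp (Complex.I * σ) ≠ 1) {g : ℝ → ℂ}
    (hg : IntervalIntegrable g volume 0 1) :
    ∃ y v : ℝ → ℂ, (∀ x, HasDerivAt y (v x) x) ∧ AbsolutelyContinuousOnInterval v 0 1 ∧
      (∀ᵐ x : ℝ, x ∈ Icc (0 : ℝ) 1 → HasDerivAt v (g x) x) ∧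
      y 1 = Complex.exp (Complex.I * σ) * y 0 ∧ v 1 = Complex.exp (Complex.I * σ) * v 0 := by
  set E := Complex.exp (Complex.I * σ) with hE
  have hE1 : E - 1 ≠ 0 := sub_ne_zero.2 hσ
  -- Extension by zero makes the first primitive continuous on all of `ℝ`, so the second one is
  -- differentiable everywhere.
  set g' : ℝ → ℂ := (Ioc (0 : ℝ) 1).indicator g with hg'
  have hgi : Integrable g' := by
    rw [intervalIntegrable_iff_integrableOn_Ioc_of_le zero_le_one] at hg
    exact hg.integrable_indicator measurableSet_Ioc
  set F : ℝ → ℂ := fun x => ∫ s in (0 : ℝ)..x, g' s with hF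
  have hFc : Continuous F :=
    intervalIntegral.continuous_primitive (fun a b => hgi.intervalIntegrable) 0
  -- The constant `C = F 1 / (E - 1)` solves `C + F 1 = E * C`, the quasi-periodicity condition; `y`
  -- is treated likewise.
  set v : ℝ → ℂ := fun x => F 1 / (E - 1) + F x with hv
  have hvc : Continuous v := by fun_prop
  set G : ℝ → ℂ := fun x => ∫ s in (0 : ℝ)..x, v s with hG
  have hF0 : F 0 = 0 := by simp [hF]
  have hG0 : G 0 = 0 := by simp [hG]
  refine ⟨fun x => G 1 / (E - 1) + G x, v, fun x => ?_, ?_, ?_, ?_, ?_⟩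
  · exact (hvc.integral_hasStrictDerivAt 0 x).hasDerivAt.const_add _
  · have h1 : AbsolutelyContinuousOnInterval (fun _ : ℝ => F 1 / (E - 1)) 0 1 :=
      contDiffOn_const.absolutelyContinuousOnInterval
    have h2 : AbsolutelyContinuousOnInterval F 0 1 :=
      (hgi.intervalIntegrable (a := 0) (b := 1)).absolutelyContinuousOnInterval_primitive
        left_mem_uIcc
    exact h1.add h2
  · have h0 : ∀ᵐ x : ℝ, x ≠ 0 := by simp [ae_iff, measure_singleton]
    filter_upwards [(hgi.intervalIntegrable (a := 0) (b := 1)).ae_hasDerivAt_integral, h0]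
      with x hx hx0 hmem
    have h := (hx (by rwa [uIcc_of_le zero_le_one]) 0 left_mem_uIcc).const_add (F 1 / (E - 1))
    have hm : x ∈ Ioc (0 : ℝ) 1 := ⟨lt_of_le_of_ne hmem.1 (Ne.symm hx0), hmem.2⟩
    rwa [hg', indicator_of_mem hm] at h
  · simp only [hG0]; field_simp; ring
  · simp only [hv, hF0]; field_simp; ring

theorem AbsolutelyContinuousOnInterval.congr_uIcc {f g : ℝ → ℂ} {a b : ℝ}
    (hf : AbsolutelyContinuousOnInterval f a b) (h : ∀ x ∈ uIcc a b, f x = g x) :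
    AbsolutelyContinuousOnInterval g a b := by
  refine Tendsto.congr' ?_ hf
  rw [EventuallyEq, eventually_inf_principal]
  refine Eventually.of_forall fun E hE => Finset.sum_congr rfl fun i hi => ?_
  rw [h _ (hE.1 i hi).1, h _ (hE.1 i hi).2]

theorem eq_of_twistedCoeff_eq {σ : ℂ} {f g : ℝ → ℂ} (hf : ContinuousOn f (Icc 0 1))
    (hg : ContinuousOn g (Icc 0 1)) (hf1 : f 1 = Complex.exp (Complex.I * σ) * f 0)
    (hg1 : g 1 = Complex.exp (Complex.I * σ) * g 0)
    (h : ∀ m, twistedCoeff σ f m = twistedCoeff σ g m) : ∀ x ∈ Icc (0 : ℝ) 1, f x = g x := by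
  intro x hx
  have h01 : uIcc (0 : ℝ) 1 = Icc 0 1 := uIcc_of_le zero_le_one
  have hz : twistedCoeff σ (fun x => f x - g x) = fun _ => 0 := by
    funext m
    rw [twistedCoeff_sub (h01 ▸ hf).intervalIntegrable (h01 ▸ hg).intervalIntegrable, h, sub_self]
  have := hasSum_twistedCoeff (σ := σ) (hf.fun_sub hg) (by rw [hf1, hg1]; ring)
    (by rw [hz]; exact summable_zero) hx
  simp only [hz, zero_mul] at this
  exact sub_eq_zero.1 (this.unique hasSum_zero)

/-- Regularity comes by comparison: the quasi-periodic solution `y` of `y'' = (q - σ²) ψ`, with `ψ`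
the series, has the same Fourier coefficients as `ψ`, because `2πm + σ ≠ 0`. Hence `ψ = y` on
`[0,1]`. -/
theorem isEigenfunction_blochSum {q : ℝ → ℂ} (hq : IsL1Plus q) {σ : ℂ} (hσ : NotPiMultiple σ) :
    IsEigenfunction q σ (σ ^ 2) (blochSum q σ) := by
  have hψc := continuousOn_blochSum q σ
  have hψ1 : blochSum q σ 1 = Complex.exp (Complex.I * σ) * blochSum q σ 0 := by
    simpa using blochSum_add_one q σ 0
  have hg := intervalIntegrable_potential_mul hq.integrable hψc (σ ^ 2)
  obtain ⟨y, v, hy, hv, hvg, hy1, hv1⟩ :=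
    exists_quasiperiodic_primitive (exp_I_mul_ne_one hσ) hg
  have heq : ∀ x ∈ Icc (0 : ℝ) 1, blochSum q σ x = y x := by
    refine eq_of_twistedCoeff_eq hψc (fun x _ => (hy x).continuousAt.continuousWithinAt) hψ1 hy1
      fun m => ?_
    have h1 := twistedCoeff_second_deriv (fun x _ => (hy x).hasDerivWithinAt) hv hvg hg hy1 hv1 m
    rw [twistedCoeff_potential_mul_blochSum hq hσ] at h1
    exact mul_left_cancel₀
      (neg_ne_zero.2 (pow_ne_zero 2 (two_pi_int_add_ne_zero hσ m))) h1
  have hder : ∀ x ∈ Icc (0 : ℝ) 1, HasDerivWithinAt (blochSum q σ) (v x) (Icc 0 1) x :=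
    fun x hx => (hy x).hasDerivWithinAt.congr heq (heq x hx)
  have hdw : ∀ x ∈ Icc (0 : ℝ) 1, derivWithin (blochSum q σ) (Icc 0 1) x = v x :=
    fun x hx => (hder x hx).derivWithin (uniqueDiffOn_Icc zero_lt_one x hx)
  refine ⟨fun x hx => (hder x hx).differentiableWithinAt, hv.congr_uIcc fun x hx => ?_, ?_, hψ1,
    ?_, ?_⟩
  · rw [uIcc_of_le zero_le_one] at hx
    exact (hdw x hx).symm
  · have h0 : ∀ᵐ x : ℝ, x ≠ 0 := by simp [ae_iff, measure_singleton]
    have h1 : ∀ᵐ x : ℝ, x ≠ 1 := by simp [ae_iff, measure_singleton]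
    filter_upwards [hvg, h0, h1] with x hx hx0 hx1 hmem
    refine ⟨_, (hx hmem).congr_of_eventuallyEq ?_, by ring⟩
    filter_upwards [isOpen_Ioo.mem_nhds (show x ∈ Ioo (0 : ℝ) 1 from
      ⟨lt_of_le_of_ne hmem.1 (Ne.symm hx0), lt_of_le_of_ne hmem.2 hx1⟩)] with z hz
    exact hdw z (Ioo_subset_Icc_self hz)
  · rw [hdw 1 (by simp), hdw 0 (by simp), hv1]
  · by_contra! h
    have h0 := twistedCoeff_blochSum_natCast q σ 0
    rw [twistedCoeff_congr (g := fun _ => 0) (fun x hx => h x (Ioc_subset_Icc_self hx)),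
      blochCoeff_zero] at h0
    simp [twistedCoeff] at h0

/-! ### Reduction to the quasi-momentum, and uniqueness -/

theorem normalization_eq_twistedCoeff (n : ℤ) (t : ℂ) (ψ : ℝ → ℂ) :
    (∫ x in (0 : ℝ)..1, ψ x * (starRingEnd ℂ)
      (Complex.exp (Complex.I * (2 * π * n + (starRingEnd ℂ) t) * x))) =
      twistedCoeff (2 * π * n + t) ψ 0 := by
  refine intervalIntegral.integral_congr fun x _ => ?_
  simp only [← Complex.exp_conj]
  congr 2
  simp only [map_mul, map_add, Complex.conj_I, Complex.conj_ofReal, Complex.conj_conj, map_ofNat,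
    map_intCast]
  push_cast
  ring

theorem exp_I_mul_two_pi_int_add (n : ℤ) (t : ℂ) :
    Complex.exp (Complex.I * (2 * π * n + t)) = Complex.exp (Complex.I * t) := by
  rw [mul_add, Complex.exp_add, exp_two_pi_int_mul_I, one_mul]

theorem isNormalizedBloch_iff (q : ℝ → ℂ) (n : ℤ) (t : ℂ) (ψ : ℝ → ℂ) :
    IsNormalizedBloch q n t ψ ↔
      IsEigenfunction q (2 * π * n + t) ((2 * π * n + t) ^ 2) ψ ∧
      twistedCoeff (2 * π * n + t) ψ 0 = 1 ∧
      ∀ x, ψ (x + 1) = Complex.exp (Complex.I * (2 * π * n + t)) * ψ x := by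
  have he := exp_I_mul_two_pi_int_add n t
  constructor
  · rintro ⟨h1, h2, h3⟩
    rw [normalization_eq_twistedCoeff] at h2
    refine ⟨⟨h1.1, h1.2, h1.3, ?_, ?_, h1.6⟩, h2, ?_⟩
    · rw [he]; exact h1.4
    · rw [he]; exact h1.5
    · rwa [he]
  · rintro ⟨h1, h2, h3⟩
    rw [he] at h3
    refine ⟨⟨h1.1, h1.2, h1.3, ?_, ?_, h1.6⟩, ?_, h3⟩
    · rw [← he]; exact h1.4
    · rw [← he]; exact h1.5
    · rwa [normalization_eq_twistedCoeff]

theorem NotPiMultiple.two_pi_int_add {t : ℂ} (ht : NotPiMultiple t) (n : ℤ) :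
    NotPiMultiple (2 * π * n + t) := by
  intro k hk
  refine ht (k - 2 * n) ?_
  push_cast
  linear_combination hk

theorem isNormalizedBloch_blochSum {q : ℝ → ℂ} (hq : IsL1Plus q) {n : ℤ} {t : ℂ}
    (ht : NotPiMultiple t) : IsNormalizedBloch q n t (blochSum q (2 * π * n + t)) := by
  rw [isNormalizedBloch_iff]
  refine ⟨isEigenfunction_blochSum hq (ht.two_pi_int_add n), ?_, blochSum_add_one q _⟩
  simpa using twistedCoeff_blochSum_natCast q (2 * π * n + t) 0

theorem exists_neg_tsum_indicator_Iic_lt {w : ℤ → ℝ} (hw : Summable fun m => ‖w m‖) {ε : ℝ}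
    (hε : 0 < ε) : ∃ M : ℤ, M < 0 ∧ ∑' m, (Iic M).indicator w m < ε := by
  have h : Tendsto (fun M : ℤ => ∑' m, (Iic M).indicator w m) atBot (𝓝 (∑' _ : ℤ, (0 : ℝ))) := by
    refine tendsto_tsum_of_dominated_convergence hw (fun m => ?_)
      (Eventually.of_forall fun M m => norm_indicator_le_norm_self _ _)
    refine tendsto_const_nhds.congr' ?_
    filter_upwards [eventually_lt_atBot m] with M hM
    rw [indicator_of_notMem (by simpa using hM)]
  rw [tsum_zero] at h
  exact ((eventually_lt_atBot 0).and (h.eventually_lt_const hε)).exists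

/-- A summable solution of the triangular system `μ_m a_m = -∑_j c_{m-j} a_j`, with `c_k = 0` for
`k ≤ 0` and `1/μ_m` summable, vanishes for negative indices. -/
theorem eq_zero_of_neg_of_triangular {a c μ : ℤ → ℂ} {Q : ℝ} (hQ : ∀ k, ‖c k‖ ≤ Q)
    (hc : ∀ k ≤ 0, c k = 0) (ha : Summable fun m => ‖a m‖) (hμ : Summable fun m => ‖(μ m)⁻¹‖)
    (hμ0 : ∀ m < 0, μ m ≠ 0) (h : ∀ m, μ m * a m = -∑' j, a j * c (m - j)) :
    ∀ m < 0, a m = 0 := by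
  have hQ0 : 0 ≤ Q := (norm_nonneg _).trans (hQ 0)
  have hsol : ∀ m < 0, a m = -((μ m)⁻¹ * ∑' j, a j * c (m - j)) := by
    intro m hm
    rw [← mul_neg, ← h m, inv_mul_cancel_left₀ (hμ0 m hm)]
  -- With `W < 1/(Q+1)`, the estimate `T ≤ W Q T` for the mass `T` of `a` on `(-∞, M]` forces `T =
  -- 0`.
  obtain ⟨M, hM0, hM⟩ := exists_neg_tsum_indicator_Iic_lt (w := fun m => ‖(μ m)⁻¹‖)
    (by simpa using hμ) (show 0 < 1 / (Q + 1) by positivity)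
  have hai : Summable ((Iic M).indicator fun m => ‖a m‖) := ha.indicator _
  have hμi : Summable ((Iic M).indicator fun m => ‖(μ m)⁻¹‖) := hμ.indicator _
  set T := ∑' m, (Iic M).indicator (fun m => ‖a m‖) m with hT
  set W := ∑' m, (Iic M).indicator (fun m => ‖(μ m)⁻¹‖) m with hW
  have hT0 : 0 ≤ T := tsum_nonneg fun m => indicator_nonneg (fun _ _ => norm_nonneg _) _
  have hconv : ∀ m ≤ M, ‖∑' j, a j * c (m - j)‖ ≤ Q * T := by
    intro m hm
    rw [hT, ← tsum_mul_left]
    refine tsum_of_norm_bounded (hai.mul_left Q).hasSum fun j => ?_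
    by_cases hj : j ≤ M
    · rw [indicator_of_mem (by simpa using hj), norm_mul, mul_comm]
      exact mul_le_mul_of_nonneg_right (hQ _) (norm_nonneg _)
    · rw [hc _ (by omega), mul_zero, norm_zero]
      exact mul_nonneg hQ0 (indicator_nonneg (fun _ _ => norm_nonneg _) _)
  have hTW : T ≤ W * (Q * T) := by
    rw [hW, ← tsum_mul_right]
    refine hai.tsum_le_tsum (fun m => ?_) (hμi.mul_right _)
    by_cases hm : m ∈ Iic M
    · rw [indicator_of_mem hm, indicator_of_mem hm, hsol m (lt_of_le_of_lt hm hM0), norm_neg,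
        norm_mul]
      exact mul_le_mul_of_nonneg_left (hconv m hm) (norm_nonneg _)
    · rw [indicator_of_notMem hm, indicator_of_notMem hm, zero_mul]
  have hT1 : T = 0 := by
    rw [lt_div_iff₀ (by positivity)] at hM
    have hW0 : 0 ≤ W := tsum_nonneg fun m => indicator_nonneg (fun _ _ => norm_nonneg _) _
    nlinarith [mul_nonneg hW0 hT0]
  have hlow : ∀ m ≤ M, a m = 0 := by
    intro m hm
    rw [hsol m (lt_of_le_of_lt hm hM0)]
    have := hconv m hm
    rw [hT1, mul_zero, norm_le_zero_iff] at this
    rw [this, mul_zero, neg_zero]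
  -- From `M` upwards, triangularity propagates the zeros one index at a time, as long as the factor
  -- `μ m` is nonzero.
  have hup : ∀ N : ℕ, ∀ m ≤ M + N, m < 0 → a m = 0 := by
    intro N
    induction N with
    | zero => exact fun m hm _ => hlow m (by simpa using hm)
    | succ N ih =>
      intro m hm hm0
      rcases le_or_gt m (M + N) with h1 | h1
      · exact ih m h1 hm0
      rw [hsol m hm0]
      have : ∀ j, a j * c (m - j) = 0 := by
        intro j
        rcases le_or_gt m j with h2 | h2
        · rw [hc _ (by omega), mul_zero]
        · rw [ih j (by push_cast at hm; omega) (by omega), zero_mul]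
      simp [this]
  intro m hm
  exact hup (m - M).toNat m (by have := Int.self_le_toNat (m - M); omega) hm

theorem eq_blochCoeff_of_triangular {q : ℝ → ℂ} (hq : IsL1Plus q) {σ : ℂ} (hσ : NotPiMultiple σ)
    {a : ℤ → ℂ} (ha : Summable fun m => ‖a m‖) (ha0 : a 0 = 1)
    (h : ∀ m : ℤ, (2 * π * m * (2 * π * m + 2 * σ)) * a m = -∑' j, a j * qCoeff q (m - j)) :
    (∀ m < 0, a m = 0) ∧ ∀ p : ℕ, a p = blochCoeff q σ p := by
  have hneg := eq_zero_of_neg_of_triangular (norm_qCoeff_le q) hq.coeff_eq_zero ha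
    (summable_norm_inv_mul_add σ) (fun m hm => eigen_factor_ne_zero hσ hm.ne) h
  refine ⟨hneg, fun p => ?_⟩
  induction p using Nat.strong_induction_on with
  | _ p ih =>
    rcases Nat.eq_zero_or_pos p with rfl | hp
    · simpa using ha0
    · have hsum : ∑' j, a j * qCoeff q (p - j) =
          ∑ j ∈ Finset.range p, qCoeff q (p - j : ℕ) * blochCoeff q σ j := by
        rw [tsum_eq_sum (s := (Finset.range p).map Nat.castEmbedding), Finset.sum_map]
        · refine Finset.sum_congr rfl fun j hj => ?_
          rw [Finset.mem_range] at hj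
          rw [Nat.castEmbedding_apply, ih j hj, mul_comm, Nat.cast_sub hj.le]
        · intro j hj
          rcases lt_or_ge j 0 with h0 | h0
          · rw [hneg j h0, zero_mul]
          · lift j to ℕ using h0
            have : p ≤ j := by simpa using hj
            rw [hq.coeff_eq_zero _ (by omega), mul_zero]
      have h1 := h p
      rw [hsum] at h1
      have h2 := eigen_factor_ne_zero hσ (m := p) (by omega)
      have h3 : dCoeff 0 σ p = -(2 * π * (p : ℤ) * (2 * π * (p : ℤ) + 2 * σ))⁻¹ := by
        simp [dCoeff]
      rw [blochCoeff_rec q σ hp, h3, neg_mul, ← mul_neg, ← h1, inv_mul_cancel_left₀ h2]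

theorem norm_twistedCoeff_le {σ : ℂ} {f : ℝ → ℂ} (hf : IntervalIntegrable f volume 0 1) (m : ℤ) :
    ‖twistedCoeff σ f m‖ ≤ (∫ x in (0 : ℝ)..1, ‖f x‖) * Real.exp ‖σ‖ := by
  refine (intervalIntegral.norm_integral_le_integral_norm zero_le_one).trans ?_
  rw [← intervalIntegral.integral_mul_const]
  refine intervalIntegral.integral_mono_on zero_le_one (intervalIntegrable_mul_mode hf _).norm
    (hf.norm.mul_const _) fun x hx => ?_
  rw [norm_mul]
  refine mul_le_mul_of_nonneg_left ?_ (norm_nonneg _)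
  have h := norm_exp_mode_le (-σ) (-m) x
  rw [norm_neg, abs_of_nonneg hx.1] at h
  have e : Complex.I * (2 * π * (-m : ℤ) + -σ) * x = -(Complex.I * (2 * π * m + σ) * x) := by
    push_cast; ring
  rw [e] at h
  exact h.trans (Real.exp_le_exp.2 (mul_le_of_le_one_right (norm_nonneg _) hx.2))

/-- Two integrations by parts show that the coefficients of `ψ` solve the triangular system. They
are summable, since those of `qψ` are bounded and the inverse factors summable, so `ψ` is the sum of
its twisted series. -/
theorem IsEigenfunction.eq_blochSum {q : ℝ → ℂ} (hq : IsL1Plus q) {σ : ℂ} (hσ : NotPiMultiple σ)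
    {ψ : ℝ → ℂ} (hψ : IsEigenfunction q σ (σ ^ 2) ψ) (h0 : twistedCoeff σ ψ 0 = 1) :
    ∀ x ∈ Icc (0 : ℝ) 1, ψ x = blochSum q σ x := by
  have hc : ContinuousOn ψ (Icc 0 1) := hψ.differentiableOn.continuousOn
  have hqψ : IntervalIntegrable (fun x => q x * ψ x) volume 0 1 :=
    hq.integrable.mul_continuousOn (by rwa [uIcc_of_le zero_le_one])
  have hcoef : ∀ m : ℤ, (2 * π * m * (2 * π * m + 2 * σ)) * twistedCoeff σ ψ m =
      -twistedCoeff σ (fun x => q x * ψ x) m := by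
    intro m
    have h := twistedCoeff_second_deriv (fun x hx => (hψ.differentiableOn x hx).hasDerivWithinAt)
      hψ.absolutelyContinuous_deriv (g := fun x => q x * ψ x - σ ^ 2 * ψ x) ?_
      (intervalIntegrable_potential_mul hq.integrable hc _) hψ.boundary hψ.boundary_deriv m
    · rw [twistedCoeff_potential_mul hq.integrable hc] at h
      linear_combination h
    · filter_upwards [hψ.equation] with x hx hmem
      obtain ⟨w, hw, he⟩ := hx hmem
      rwa [show q x * ψ x - σ ^ 2 * ψ x = w by linear_combination he]
  set K := (∫ x in (0 : ℝ)..1, ‖q x * ψ x‖) * Real.exp ‖σ‖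
  have hs : Summable fun m => ‖twistedCoeff σ ψ m‖ := by
    -- The factor vanishes at `m = 0`; there the normalization supplies the value `1`.
    have h1 : Summable fun m : ℤ => ‖((2 * π * m * (2 * π * m + 2 * σ))⁻¹ : ℂ)‖ * K +
        if m = 0 then 1 else 0 :=
      ((summable_norm_inv_mul_add σ).mul_right K).add
        (summable_of_ne_finset_zero (s := {0}) fun m hm => if_neg (by simpa using hm))
    refine Summable.of_nonneg_of_le (fun _ => norm_nonneg _) (fun m => ?_) h1
    by_cases hm : m = 0
    · subst hm
      simp [h0]
    · rw [if_neg hm, add_zero, ← inv_mul_cancel_left₀ (eigen_factor_ne_zero hσ hm)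
        (twistedCoeff σ ψ m), hcoef, norm_mul, norm_neg]
      exact mul_le_mul_of_nonneg_left (norm_twistedCoeff_le hqψ m) (norm_nonneg _)
  have hsum := fun x hx => hasSum_twistedCoeff (x := x) hc hψ.boundary hs.of_norm hx
  obtain ⟨hneg, hnat⟩ := eq_blochCoeff_of_triangular hq hσ hs h0 fun m => by
    have e := (hasSum_twistedCoeff_mul_tsum (σ := σ) hq.integrable hs (fun j => j) m).tsum_eq
    rw [hcoef, e]
    congr 1
    refine twistedCoeff_congr (fun x hx => ?_) m
    rw [(hsum x (Ioc_subset_Icc_self hx)).tsum_eq.symm]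
  intro x hx
  refine (hsum x hx).unique ?_
  rw [← (Nat.cast_injective (R := ℤ)).hasSum_iff]
  · simp only [Function.comp_def, hnat]
    refine Summable.hasSum (Summable.of_norm_bounded
      ((summable_norm_blochCoeff q σ).mul_right (Real.exp (‖σ‖ * 1))) fun p => norm_mode_le _ _ _ ?_)
    rw [abs_of_nonneg hx.1]
    exact hx.2
  · intro m hm
    rw [hneg m, zero_mul]
    by_contra! h
    exact hm ⟨m.toNat, Int.toNat_of_nonneg h⟩

theorem eq_of_quasiperiodic {c : ℂ} (hc : c ≠ 0) {f g : ℝ → ℂ} (hf : ∀ x, f (x + 1) = c * f x)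
    (hg : ∀ x, g (x + 1) = c * g x) (h : ∀ x ∈ Icc (0 : ℝ) 1, f x = g x) : f = g := by
  have key : ∀ k : ℤ, ∀ x ∈ Icc (0 : ℝ) 1, f (x + k) = g (x + k) := by
    intro k
    induction k using Int.induction_on with
    | zero => simpa using h
    | succ k ih =>
      intro x hx
      have := ih x hx
      push_cast at this ⊢
      rw [← add_assoc, hf, hg, this]
    | pred k ih =>
      intro x hx
      have := ih x hx
      have e : x + (-k : ℤ) = x + ((-k - 1 : ℤ) : ℝ) + 1 := by push_cast; ring
      rw [e, hf, hg] at this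
      exact mul_left_cancel₀ hc this
  funext x
  have := key ⌊x⌋ (Int.fract x) ⟨Int.fract_nonneg x, (Int.fract_lt_one x).le⟩
  rwa [Int.fract_add_floor] at this

theorem IsNormalizedBloch.eq_blochSum {q : ℝ → ℂ} (hq : IsL1Plus q) {n : ℤ} {t : ℂ}
    (ht : NotPiMultiple t) {ψ : ℝ → ℂ} (hψ : IsNormalizedBloch q n t ψ) :
    ψ = blochSum q (2 * π * n + t) := by
  rw [isNormalizedBloch_iff] at hψ
  exact eq_of_quasiperiodic (Complex.exp_ne_zero _) hψ.2.2 (blochSum_add_one q _)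
    (hψ.1.eq_blochSum hq (ht.two_pi_int_add n) hψ.2.1)

theorem existsUnique_isNormalizedBloch {q : ℝ → ℂ} (hq : IsL1Plus q) (n : ℤ) {t : ℂ}
    (ht : NotPiMultiple t) : ∃! ψ : ℝ → ℂ, IsNormalizedBloch q n t ψ :=
  ⟨_, isNormalizedBloch_blochSum hq ht, fun _ h => h.eq_blochSum hq ht⟩

theorem blochFunction_eq_blochSum {q : ℝ → ℂ} (hq : IsL1Plus q) (n : ℤ) {t : ℂ}
    (ht : NotPiMultiple t) : blochFunction q n t = blochSum q (2 * π * n + t) :=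
  (Classical.epsilon_spec (existsUnique_isNormalizedBloch hq n ht).exists).eq_blochSum hq ht

/-! ### Behaviour near a resonance -/

theorem tendsto_dCoeff_resonance {P p : ℕ} (hp : 1 ≤ p) (hpP : p ≠ P) :
    Tendsto (fun δ : ℂ => dCoeff 0 (-(π * P) + δ) p) (𝓝 0) (𝓝 (dCoeff 0 (-(π * P)) p)) := by
  have hc : ContinuousAt (fun δ : ℂ => dCoeff 0 (-(π * P) + δ) p) 0 := by
    simp only [dCoeff]
    refine ContinuousAt.neg (ContinuousAt.inv₀ (by fun_prop) ?_)
    have h1 : (p : ℂ) - P ≠ 0 := sub_ne_zero.2 (by exact_mod_cast hpP)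
    have h2 : (p : ℂ) ≠ 0 := by exact_mod_cast (by omega : p ≠ 0)
    have h3 : (π : ℂ) ≠ 0 := by simp [Real.pi_ne_zero]
    have e : (2 * π * p * (2 * π * (2 * (0 : ℤ) + p) + 2 * (-(π * P) + 0)) : ℂ) =
        4 * π ^ 2 * p * (p - P) := by push_cast; ring
    rw [e]
    exact mul_ne_zero (mul_ne_zero (mul_ne_zero (by norm_num) (pow_ne_zero 2 h3)) h2) h1
  simpa [ContinuousAt] using hc

/-- With `R = p - P ≥ 1`, the second factor has norm at least `2πR - 2 ≥ R`, and `P + R ≤ (P + 1)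
R`. The bound is uniform in `δ`. -/
theorem norm_dCoeff_resonance_le {P p : ℕ} (hp : P < p) {δ : ℂ} (hδ : ‖δ‖ ≤ 1) :
    ‖dCoeff 0 (-(π * P) + δ) p‖ ≤ (P + 1) * ((p : ℝ) ^ 2)⁻¹ := by
  obtain ⟨r, rfl⟩ : ∃ r, p = P + (r + 1) := ⟨p - P - 1, by omega⟩
  have hπ := Real.pi_gt_three
  set R : ℝ := (r : ℝ) + 1 with hR
  have hR1 : 1 ≤ R := by rw [hR]; linarith [Nat.cast_nonneg (α := ℝ) r]
  have hP0 : (0 : ℝ) ≤ P := Nat.cast_nonneg P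
  have e : (2 * π * (2 * (0 : ℤ) + ((P + (r + 1) : ℕ) : ℂ)) + 2 * (-(π * P) + δ) : ℂ) =
      ((2 * π * R : ℝ) : ℂ) - (-(2 * δ)) := by
    rw [hR]; push_cast; ring
  have h1 : R ≤ ‖(2 * π * (2 * (0 : ℤ) + ((P + (r + 1) : ℕ) : ℂ)) + 2 * (-(π * P) + δ) : ℂ)‖ := by
    rw [e]
    refine le_trans ?_ (norm_sub_norm_le _ _)
    rw [Complex.norm_real, Real.norm_eq_abs, abs_of_pos (by positivity), norm_neg, norm_mul,
      RCLike.norm_ofNat]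
    nlinarith
  have h2 : (P + R : ℝ) ≤ ‖(2 * π * ((P + (r + 1) : ℕ) : ℂ) : ℂ)‖ := by
    have : (2 * π * ((P + (r + 1) : ℕ) : ℂ) : ℂ) = ((2 * π * (P + R) : ℝ) : ℂ) := by
      rw [hR]; push_cast; ring
    rw [this, Complex.norm_real, Real.norm_eq_abs, abs_of_pos (by positivity)]
    nlinarith
  have e2 : (((P + (r + 1) : ℕ) : ℝ)) = P + R := by rw [hR]; push_cast; ring
  rw [dCoeff, norm_neg, norm_inv, norm_mul, e2]
  have h3 : (P + R) ^ 2 / (P + 1) ≤ (P + R) * R := by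
    rw [div_le_iff₀ (by positivity)]
    nlinarith [mul_nonneg hP0 (sub_nonneg.2 hR1), mul_nonneg (by positivity : 0 ≤ P + R)
      (mul_nonneg hP0 (sub_nonneg.2 hR1))]
  calc _ ≤ ((P + R) ^ 2 / (P + 1))⁻¹ :=
        inv_anti₀ (by positivity) (h3.trans (mul_le_mul h2 h1 (by positivity) (norm_nonneg _)))
    _ = _ := by rw [inv_div, div_eq_mul_inv]

/-- The coefficients of the Bloch function near the resonance at the mode `P`, rescaled by the
vanishing denominator. -/
noncomputable def scaledCoeff (q : ℝ → ℂ) (P : ℕ) (δ : ℂ) (p : ℕ) : ℂ :=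
  -(4 * π * P * δ) * blochCoeff q (-(π * P) + δ) p

/-- The limits of the rescaled coefficients at the resonance. -/
noncomputable def limitCoeff (q : ℝ → ℂ) (P p : ℕ) : ℂ :=
  if p < P then 0 else normingNumber q P * blochCoeff q (π * P) (p - P)

theorem scaledCoeff_rec (q : ℝ → ℂ) (P : ℕ) (δ : ℂ) {p : ℕ} (hp : 1 ≤ p) :
    scaledCoeff q P δ p = dCoeff 0 (-(π * P) + δ) p *
      ∑ j ∈ Finset.range p, qCoeff q (p - j : ℕ) * scaledCoeff q P δ j := by
  simp only [scaledCoeff]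
  rw [blochCoeff_rec q _ hp, mul_left_comm, Finset.mul_sum]
  congr 1
  exact Finset.sum_congr rfl fun j _ => by ring

/-- The weight at `P + r` for `-πP` equals the weight at `r` for `πP`, so the shifted recursion is
the one of the limit series. It starts strictly above `P`, where the weight no longer degenerates.
-/
theorem limitCoeff_rec (q : ℝ → ℂ) {P p : ℕ} (hp : P < p) :
    limitCoeff q P p = dCoeff 0 (-(π * P)) p *
      ∑ j ∈ Finset.range p, qCoeff q (p - j : ℕ) * limitCoeff q P j := by
  obtain ⟨r, rfl⟩ : ∃ r, p = P + r := ⟨p - P, by omega⟩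
  rw [Finset.sum_range_add, Finset.sum_eq_zero (s := Finset.range P), zero_add, limitCoeff,
    if_neg (by omega), Nat.add_sub_cancel_left, blochCoeff_rec q _ (by omega : 1 ≤ r),
    mul_left_comm, Finset.mul_sum]
  · congr 1
    · simp only [dCoeff]
      congr 2
      push_cast
      ring
    · refine Finset.sum_congr rfl fun j _ => ?_
      rw [limitCoeff, if_neg (by omega), Nat.add_sub_cancel_left, Nat.add_sub_add_left]
      ring
  · intro j hj
    rw [limitCoeff, if_pos (Finset.mem_range.1 hj), mul_zero]

theorem tendsto_blochCoeff_resonance (q : ℝ → ℂ) (P : ℕ) {p : ℕ} (hp : p < P) :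
    Tendsto (fun δ : ℂ => blochCoeff q (-(π * P) + δ) p) (𝓝 0)
      (𝓝 (blochCoeff q (-(π * P)) p)) := by
  induction p using Nat.strong_induction_on with
  | _ p ih =>
    rcases Nat.eq_zero_or_pos p with rfl | h0
    · simp only [blochCoeff_zero]
      exact tendsto_const_nhds
    · simp only [blochCoeff_rec q _ h0]
      refine (tendsto_dCoeff_resonance h0 hp.ne).mul (tendsto_finsetSum _ fun j hj => ?_)
      rw [Finset.mem_range] at hj
      exact (ih j hj (hj.trans hp)).const_mul _

theorem tendsto_scaledCoeff (q : ℝ → ℂ) {P : ℕ} (hP : 1 ≤ P) (p : ℕ) :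
    Tendsto (fun δ : ℂ => scaledCoeff q P δ p) (𝓝[≠] 0) (𝓝 (limitCoeff q P p)) := by
  induction p using Nat.strong_induction_on with
  | _ p ih =>
    rcases lt_trichotomy p P with h | rfl | h
    · rw [limitCoeff, if_pos h]
      have h1 : Tendsto (fun δ : ℂ => -(4 * π * P * δ)) (𝓝 0) (𝓝 0) :=
        Continuous.tendsto' (by fun_prop) _ _ (by simp)
      simpa [scaledCoeff] using
        (h1.mul (tendsto_blochCoeff_resonance q P h)).mono_left nhdsWithin_le_nhds
    · rw [limitCoeff, if_neg (lt_irrefl _), Nat.sub_self, blochCoeff_zero, mul_one,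
        normingNumber_eq_convolution q hP]
      have h1 : Tendsto (fun δ : ℂ => ∑ j ∈ Finset.range p,
          qCoeff q (p - j : ℕ) * blochCoeff q (-(π * p) + δ) j) (𝓝 0)
          (𝓝 (∑ j ∈ Finset.range p, qCoeff q (p - j : ℕ) * blochCoeff q (-(π * p)) j)) :=
        tendsto_finsetSum _ fun j hj =>
          (tendsto_blochCoeff_resonance q p (Finset.mem_range.1 hj)).const_mul _
      refine (h1.mono_left nhdsWithin_le_nhds).congr' ?_
      filter_upwards [self_mem_nhdsWithin] with δ hδ
      have hδ0 : δ ≠ 0 := hδ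
      have h3 : (π : ℂ) ≠ 0 := by simp [Real.pi_ne_zero]
      have h4 : (p : ℂ) ≠ 0 := by exact_mod_cast (by omega : p ≠ 0)
      have e : -(4 * π * p * δ) * dCoeff 0 (-(π * p) + δ) p = 1 := by
        have : (2 * π * p * (2 * π * (2 * (0 : ℤ) + p) + 2 * (-(π * p) + δ)) : ℂ) =
            4 * π * p * δ := by push_cast; ring
        rw [dCoeff, this, neg_mul_neg, mul_inv_cancel₀]
        exact mul_ne_zero (mul_ne_zero (mul_ne_zero (by norm_num) h3) h4) hδ0
      rw [scaledCoeff, blochCoeff_rec q _ hP, ← mul_assoc, e, one_mul]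
    · rw [limitCoeff_rec q h]
      simp only [fun δ => scaledCoeff_rec q P δ (by omega : 1 ≤ p)]
      refine ((tendsto_dCoeff_resonance (by omega) h.ne').mono_left nhdsWithin_le_nhds).mul
        (tendsto_finsetSum _ fun j hj => ?_)
      exact (ih j (Finset.mem_range.1 hj)).const_mul _

theorem exists_summable_bound_scaledCoeff (q : ℝ → ℂ) {P : ℕ} (hP : 1 ≤ P) :
    ∃ B : ℕ → ℝ, Summable B ∧ ∀ᶠ δ : ℂ in 𝓝[≠] 0, ∀ p, ‖scaledCoeff q P δ p‖ ≤ B p := by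
  set Q := ∫ x in (0 : ℝ)..1, ‖q x‖ with hQdef
  have hQ : 0 ≤ Q := integral_norm_nonneg q
  set w : ℕ → ℝ := fun p => (P + 1) * ((p : ℝ) ^ 2)⁻¹ * Q with hw
  have hw0 : ∀ p, 0 ≤ w p := fun p => by positivity
  have hws : Summable w :=
    ((Real.summable_nat_pow_inv.2 one_lt_two).mul_left _).mul_right _
  -- Gronwall starts just past the resonance. The modes up to `P` converge, so their total norm is
  -- eventually below `S + 1`.
  set S := ∑ j ∈ Finset.range (P + 1), ‖limitCoeff q P j‖ with hS
  set K := (S + 1) * Real.exp (∑' j, w j) with hK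
  have hK0 : 0 ≤ K := by positivity
  refine ⟨fun p => w p * K + if p ∈ Finset.range (P + 1) then K else 0,
    (hws.mul_right K).add (summable_of_ne_finset_zero fun p hp => if_neg hp), ?_⟩
  have h1 : Tendsto (fun δ : ℂ => ∑ j ∈ Finset.range (P + 1), ‖scaledCoeff q P δ j‖) (𝓝[≠] 0)
      (𝓝 S) := tendsto_finsetSum _ fun j _ => (tendsto_scaledCoeff q hP j).norm
  filter_upwards [h1.eventually_lt_const (lt_add_one S),
    nhdsWithin_le_nhds (Metric.ball_mem_nhds (0 : ℂ) one_pos)] with δ hδ hδ1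
  rw [mem_ball_zero_iff] at hδ1
  have hrec : ∀ p, P + 1 ≤ p →
      ‖scaledCoeff q P δ p‖ ≤ w p * ∑ j ∈ Finset.range p, ‖scaledCoeff q P δ j‖ := by
    intro p hp
    rw [scaledCoeff_rec q P δ (by omega : 1 ≤ p), norm_mul, hw, mul_assoc]
    exact mul_le_mul (norm_dCoeff_resonance_le hp hδ1.le) (norm_convolution_le q _ p)
      (norm_nonneg _) (by positivity)
  have hsum : ∀ p, ∑ j ∈ Finset.range p, ‖scaledCoeff q P δ j‖ ≤ K := fun p =>
    (sum_range_le_mul_exp_tsum (fun _ => norm_nonneg _) hw0 hws hrec p).trans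
      (mul_le_mul_of_nonneg_right hδ.le (Real.exp_pos _).le)
  intro p
  split_ifs with hp
  · have h2 : ‖scaledCoeff q P δ p‖ ≤ K :=
      (Finset.single_le_sum (f := fun j => ‖scaledCoeff q P δ j‖) (fun _ _ => norm_nonneg _)
        (Finset.self_mem_range_succ p)).trans (hsum (p + 1))
    linarith [mul_nonneg (hw0 p) hK0]
  · rw [add_zero]
    exact (hrec p (by simpa using hp)).trans (mul_le_mul_of_nonneg_left (hsum p) (hw0 p))

/-- The shift `p = P + r` turns the exponent `2πp - πP` into `2πr + πP`. -/
theorem tsum_limitCoeff (q : ℝ → ℂ) (P : ℕ) (x : ℝ) :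
    ∑' p : ℕ, limitCoeff q P p * Complex.exp (Complex.I * (2 * π * (p : ℤ) + -(π * P)) * x) =
      normingNumber q P * blochSum q (π * P) x := by
  rw [blochSum, ← tsum_mul_left, ← (add_left_injective P).tsum_eq]
  · refine tsum_congr fun r => ?_
    rw [limitCoeff, if_neg (by omega), Nat.add_sub_cancel, mul_assoc]
    congr 3
    push_cast
    ring_nf
  · intro p hp
    refine ⟨p - P, Nat.sub_add_cancel ?_⟩
    by_contra! h
    exact hp (by simp [limitCoeff, h])

/-- The Bloch function, rescaled by the vanishing denominator, converges at a resonance. -/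
theorem tendsto_mul_blochSum_resonance (q : ℝ → ℂ) {P : ℕ} (hP : 1 ≤ P) (x₀ : ℝ) :
    Tendsto (fun y : ℂ × ℝ => -(4 * π * P * y.1) * blochSum q (-(π * P) + y.1) y.2)
      (𝓝[≠] 0 ×ˢ 𝓝 x₀) (𝓝 (normingNumber q P * blochSum q (π * P) x₀)) := by
  obtain ⟨B, hB, hle⟩ := exists_summable_bound_scaledCoeff q hP
  rw [← tsum_limitCoeff]
  simp only [blochSum, ← tsum_mul_left, ← mul_assoc]
  refine tendsto_tsum_of_dominated_convergence
    (bound := fun p => B p * Real.exp ((‖(π * P : ℂ)‖ + 1) * (|x₀| + 1)))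
    (hB.mul_right _) (fun p => ?_) ?_
  · refine ((tendsto_scaledCoeff q hP p).comp tendsto_fst).mul ?_
    have hc : Continuous fun y : ℂ × ℝ =>
        Complex.exp (Complex.I * (2 * π * (p : ℤ) + (-(π * P) + y.1)) * y.2) := by fun_prop
    have h := hc.tendsto (0, x₀)
    rw [nhds_prod_eq, add_zero] at h
    exact h.mono_left (prod_mono nhdsWithin_le_nhds le_rfl)
  · have h1 : ∀ᶠ δ : ℂ in 𝓝[≠] 0, ‖δ‖ < 1 := by
      filter_upwards [nhdsWithin_le_nhds (Metric.ball_mem_nhds (0 : ℂ) one_pos)] with δ hδ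
      simpa using hδ
    have h2 := continuous_abs.continuousAt.eventually_lt_const (lt_add_one |x₀|)
    filter_upwards [(hle.and h1).prod_mk h2] with y hy p
    obtain ⟨⟨hb, hy1⟩, hx⟩ := hy
    refine (norm_mode_le _ _ _ hx.le).trans ?_
    refine mul_le_mul (hb p) (Real.exp_le_exp.2 (mul_le_mul_of_nonneg_right ?_ (by positivity)))
      (Real.exp_pos _).le ((norm_nonneg _).trans (hb p))
    refine (norm_add_le _ _).trans ?_
    rw [norm_neg]
    linarith

/-! ### Locally uniform convergence -/

theorem blochSeries_eq_blochSum (q : ℝ → ℂ) (n : ℤ) (t : ℂ) :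
    blochSeries q n t = blochSum q (2 * π * n + t) := by
  funext x
  have hs : Summable fun p : ℕ => blochCoeff q (2 * π * n + t) p *
      Complex.exp (Complex.I * (2 * π * (p : ℤ) + (2 * π * n + t)) * x) :=
    Summable.of_norm_bounded ((summable_norm_blochCoeff q _).mul_right _)
      fun p => norm_mode_le _ _ _ le_rfl
  rw [blochSeries, blochSum, hs.tsum_eq_zero_add, blochCoeff_zero, one_mul]
  congr 1
  · congr 1; push_cast; ring
  · refine tsum_congr fun j => ?_
    rw [cCoeff_eq, blochCoeff, if_neg (Nat.succ_ne_zero j)]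
    congr 2
    push_cast
    ring

theorem summable_norm_cCoeff (q : ℝ → ℂ) (n : ℤ) (t : ℂ) :
    Summable fun p : ℕ => ‖cCoeff q n t (p + 1)‖ := by
  refine ((summable_nat_add_iff 1).2 (summable_norm_blochCoeff q (2 * π * n + t))).congr fun p => ?_
  rw [cCoeff_eq, blochCoeff, if_neg (Nat.succ_ne_zero p)]

theorem notPiMultiple_of_norm_lt_one {δ : ℂ} (h0 : δ ≠ 0) (h1 : ‖δ‖ < 1) (k : ℤ) :
    NotPiMultiple (π * k + δ) := by
  intro j hj
  have e : δ = ((π * (j - k : ℤ) : ℝ) : ℂ) := by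
    push_cast; linear_combination hj
  have hjk : j - k ≠ 0 := by
    intro h
    rw [h] at e
    exact h0 (by simpa using e)
  have h2 : (1 : ℝ) ≤ |((j - k : ℤ) : ℝ)| := by exact_mod_cast Int.one_le_abs hjk
  rw [e, Complex.norm_real, Real.norm_eq_abs, abs_mul, abs_of_pos Real.pi_pos] at h1
  nlinarith [Real.pi_gt_three]

/-- Both limits at once: `t₀ = 0` corresponds to `N = 2n` and `t₀ = π` to `N = 2n + 1`. The sign in
`δ = t₀ - t` turns `-4πNδ` into `4πN(t - t₀)`. -/
theorem tendstoLocallyUniformly_blochFunction {q : ℝ → ℂ} (hq : IsL1Plus q) {N : ℕ} (hN : 1 ≤ N)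
    {n : ℤ} {t₀ : ℂ} (h : 2 * π * n + t₀ = π * N) :
    TendstoLocallyUniformly
      (fun (t : ℂ) (x : ℝ) => 4 * N * (t - t₀) * π * blochFunction q (-n) (-t) x)
      (fun x : ℝ => normingNumber q N * blochSeries q n t₀ x) (𝓝[≠] t₀) := by
  rw [tendstoLocallyUniformly_iff_forall_tendsto]
  intro x₀
  rw [blochSeries_eq_blochSum, h]
  -- Since the limit function is continuous, joint convergence in `(t, x)` at each `x₀` gives local
  -- uniformity.
  refine Tendsto.mono_right ?_
    (nhds_le_uniformity (normingNumber q N * blochSum q (π * N) x₀))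
  have hδ : Tendsto (fun t : ℂ => t₀ - t) (𝓝[≠] t₀) (𝓝[≠] 0) := by
    refine tendsto_nhdsWithin_iff.2 ⟨?_, ?_⟩
    · exact (Continuous.tendsto' (by fun_prop) _ _ (sub_self t₀)).mono_left nhdsWithin_le_nhds
    · filter_upwards [self_mem_nhdsWithin] with t ht
      exact sub_ne_zero.2 (Ne.symm ht)
  refine Tendsto.prodMk_nhds ?_ ?_
  · exact ((continuous_const.mul (continuous_blochSum q _)).tendsto x₀).comp tendsto_snd
  · refine ((tendsto_mul_blochSum_resonance q hN x₀).comp (hδ.prodMap tendsto_id)).congr' ?_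
    have h1 : ∀ᶠ t : ℂ in 𝓝[≠] t₀, NotPiMultiple (-t) := by
      filter_upwards [self_mem_nhdsWithin, nhdsWithin_le_nhds (Metric.ball_mem_nhds t₀ one_pos)]
        with t ht ht1
      have := notPiMultiple_of_norm_lt_one (sub_ne_zero.2 (Ne.symm ht : t₀ ≠ t))
        (by rwa [Metric.mem_ball', dist_eq_norm] at ht1) (2 * n - N)
      convert this using 1
      push_cast
      linear_combination -h
    filter_upwards [h1.prod_inl (𝓝 x₀)] with y hy
    have e : -(π * N) + (t₀ - y.1) = 2 * π * (-n : ℤ) + -y.1 := by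
      push_cast
      linear_combination h
    simp only [Function.comp_apply, Prod.map_fst, Prod.map_snd, id_eq]
    rw [blochFunction_eq_blochSum hq _ hy, e]
    ring

theorem theorem3 (q : ℝ → ℂ) (hq : IsL1Plus q) :
    -- for `t ∉ πℤ` the function `Ψ_{n,t}` is well defined
    (∀ (n : ℤ) (t : ℂ), NotPiMultiple t → ∃! ψ : ℝ → ℂ, IsNormalizedBloch q n t ψ) ∧
    -- `t → 0`
    (∀ n : ℕ, 1 ≤ n →
      Summable (fun p : ℕ => ‖cCoeff q n 0 (p + 1)‖) ∧
      TendstoLocallyUniformly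
        (fun (t : ℂ) (x : ℝ) => 8 * n * π * t * blochFunction q (-n) (-t) x)
        (fun x : ℝ => normingNumber q (2 * n) * blochSeries q n 0 x) (𝓝[≠] 0)) ∧
    -- `t → π`
    (∀ n : ℕ,
      Summable (fun p : ℕ => ‖cCoeff q n π (p + 1)‖) ∧
      TendstoLocallyUniformly
        (fun (t : ℂ) (x : ℝ) => 4 * (2 * n + 1) * (t - π) * π * blochFunction q (-n) (-t) x)
        (fun x : ℝ => normingNumber q (2 * n + 1) * blochSeries q n π x) (𝓝[≠] (π : ℂ))) := by
  refine ⟨fun n t ht => existsUnique_isNormalizedBloch hq n ht,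
    fun n hn => ⟨summable_norm_cCoeff q n 0, ?_⟩, fun n => ⟨summable_norm_cCoeff q n π, ?_⟩⟩
  · have h := tendstoLocallyUniformly_blochFunction hq (N := 2 * n) (n := n) (t₀ := 0)
      (by omega) (by push_cast; ring)
    convert h using 3
    push_cast
    ring
  · have h := tendstoLocallyUniformly_blochFunction hq (N := 2 * n + 1) (n := n) (t₀ := π)
      (by omega) (by push_cast; ring)
    convert h using 3
    push_cast
    ring
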